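/- All matroids are finite. Let $M=(E,r)$ be a loopless matroid and let $m\ge 1$ be an integer. For each $e\in E$ let $T_e$ be a set of size $m$, where these sets are pairwise disjoint and disjoint from $E$; let $T=\bigcup_{e\in E}T_e$, and let $a\notin E\cup T$. For $S\subseteq E$ put $q(S)=S\cup\{a\}\cup\bigcup_{e\in S}T_e$. A cyclic flat of a matroid $N$ is a flat $F$ for which $N|F$ has no coloops; $\mathcal Z(N)$ is the lattice, under inclusion, of the cyclic flats of $N$. The free $m$-cone $Q_m(M)$ is the (unique) matroid on $E\cup T\cup\{a\}$ whose cyclic flats are the cyclic flats $Z$ of $M$, of rank $r(Z)$, together with the sets $q(F)$, of rank $r(F)+1$, for all nonempty flats $F$ of $M$. The configuration of a matroid $N$ is the triple $(L,s,\rho)$ (up to isomorphism), where $L$ is a lattice for which there is an isomorphism $\phi:L\to\mathcal Z(N)$ such that $s(x)=|\phi(x)|$ and $\rho(x)=r_N(\phi(x))$ for all $x\in L$. **Theorem 4.4.** Let $M$ and $M'$ be loopless matroids on ground sets $E$ and $E'$, and for integers $m,m'\ge 1$ let $Q=Q_m(M)$ and $Q'=Q_{m'}(M')$, with tips $a$ and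 $a'$. 1. If $m>1$ and $m'>1$, and $Q\setminus a$ and $Q'\setminus a'$ have the same configuration, then $M$ and $M'$ are isomorphic. (That is, the configuration of $Q\setminus a$ determines $M$ up to isomorphism; $m$ need not be known.) 2. If $m=m'>1$, and $Q\setminus E$ and $Q'\setminus E'$ have the same configuration, then $M$ and $M'$ are isomorphic. (That is, $m$ together with the configuration of $Q\setminus E$ determines $M$ up to isomorphism.) 3. If $m=m'>2$, and $Q\setminus(E\cup a)$ and $Q'\setminus(E'\cup a')$ have the same configuration, then $M$ and $M'$ are isomorphic. (That is, $m$ together with the configuration of $Q\setminus(E\cup a)$ determines $M$ up to isomorphism.) -/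

import Mathlib

open scoped Matroid

/-- Elements of the free `m`-cone of a matroid with elements in `α`: an element `base e` for
each `e`, the `m` elements `copy e i` of the set `T_e`, and the tip `a`. -/
inductive ConeElt (α : Type*) (m : ℕ) : Type _
  | base (e : α) : ConeElt α m
  | copy (e : α) (i : Fin m) : ConeElt α m
  | tip : ConeElt α m

namespace Matroid

/-- A set `A` of elements of `M` is cyclic if `M|A` has no coloops. -/
def IsCyclic {α : Type*} (M : Matroid α) (A : Set α) : Prop :=
  A ⊆ M.E ∧ ∀ e, ¬ (M ↾ A).IsColoop e

/-- A cyclic flat is a flat that is cyclic. -/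
def IsCyclicFlat {α : Type*} (M : Matroid α) (F : Set α) : Prop :=
  M.IsFlat F ∧ M.IsCyclic F

/-- `(L, s, ρ)` is a configuration of `M`: the ordered set `L` is isomorphic to the lattice
`Z(M)` of cyclic flats of `M`, ordered by inclusion, in such a way that `s` and `ρ` record the
sizes and the ranks of the cyclic flats. (`L` is then a lattice, since `Z(M)` is one.) -/
def IsConfiguration {α L : Type*} [PartialOrder L] (M : Matroid α) (s ρ : L → ℕ) : Prop :=
  ∃ φ : L ≃o {F : Set α // M.IsCyclicFlat F},
    ∀ x : L, ((φ x).1.encard = s x) ∧ M.eRk (φ x).1 = ρ x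

/-- Matroid isomorphism: a bijection of ground sets that preserves independence in both
directions. -/
def IsIsomorphic {α β : Type*} (M : Matroid α) (N : Matroid β) : Prop :=
  ∃ f : M.E ≃ N.E, ∀ I : Set M.E,
    M.Indep (Subtype.val '' I) ↔ N.Indep (Subtype.val '' (f '' I))

/-- The cone of a set `S`: the union of `S`, the tip, and the sets `T_e` for `e ∈ S`. -/
def coneSet {α : Type*} (m : ℕ) (S : Set α) : Set (ConeElt α m) :=
  ConeElt.base '' S ∪ {ConeElt.tip} ∪ ⋃ e ∈ S, Set.range (ConeElt.copy e)

/-- `Q` is the matroid on `E ∪ T ∪ {a}` whose cyclic flats are the cyclic flats of `M`, with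
the ranks that they have in `M`, and the cones of the nonempty flats `F` of `M`, with ranks
`r(F) + 1`. -/
structure IsFreeCone {α : Type*} (M : Matroid α) (m : ℕ) (Q : Matroid (ConeElt α m)) :
    Prop where
  ground_eq : Q.E = coneSet m M.E
  isCyclicFlat_iff : ∀ Z : Set (ConeElt α m), Q.IsCyclicFlat Z ↔
    (∃ F, M.IsCyclicFlat F ∧ Z = ConeElt.base '' F) ∨
      ∃ F, M.IsFlat F ∧ F.Nonempty ∧ Z = coneSet m F
  eRk_base : ∀ F, M.IsCyclicFlat F → Q.eRk (ConeElt.base '' F) = M.eRk F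
  eRk_cone : ∀ F, M.IsFlat F → F.Nonempty → Q.eRk (coneSet m F) = M.eRk F + 1

section Existence

/- Existence and uniqueness of the free cone. -/

open Set

variable {α : Type*} {m : ℕ}

/-- The projection of a set of elements of the cone to `E`, forgetting the tip. -/
def coneProj (S : Set (ConeElt α m)) : Set α :=
  {e | ConeElt.base e ∈ S ∨ ∃ i, ConeElt.copy e i ∈ S}

theorem base_mem_coneSet {S : Set α} {e : α} :
    (ConeElt.base e : ConeElt α m) ∈ coneSet m S ↔ e ∈ S := by
  simp [coneSet]

theorem copy_mem_coneSet {S : Set α} {e : α} {i : Fin m} :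
    (ConeElt.copy e i : ConeElt α m) ∈ coneSet m S ↔ e ∈ S := by
  simp [coneSet]

theorem tip_mem_coneSet {S : Set α} : (ConeElt.tip : ConeElt α m) ∈ coneSet m S := by
  simp [coneSet]

theorem base_injective : Function.Injective (ConeElt.base : α → ConeElt α m) :=
  fun _ _ h => by injection h

theorem coneSet_finite {S : Set α} (hS : S.Finite) : (coneSet m S).Finite :=
  ((hS.image _).union (finite_singleton _)).union
    (hS.biUnion fun _ _ => finite_range _)

theorem coneProj_mono {S T : Set (ConeElt α m)} (h : S ⊆ T) : coneProj S ⊆ coneProj T := by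
  rintro e (he | ⟨i, he⟩)
  · exact Or.inl (h he)
  · exact Or.inr ⟨i, h he⟩

theorem coneProj_union (S T : Set (ConeElt α m)) :
    coneProj (S ∪ T) = coneProj S ∪ coneProj T := by
  ext e; simp only [coneProj, mem_union, mem_ofPred_eq]; grind

theorem coneProj_coneSet (S : Set α) : coneProj (coneSet m S) = S := by
  ext e; simp [coneProj, base_mem_coneSet, copy_mem_coneSet]

theorem coneProj_base_image (S : Set α) :
    coneProj (ConeElt.base '' S : Set (ConeElt α m)) = S := by
  ext e; simp [coneProj]

theorem coneProj_encard_le (S : Set (ConeElt α m)) : (coneProj S).encard ≤ S.encard := by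
  classical
  have h : ∀ e : coneProj S, ∃ x ∈ S, x = ConeElt.base e.1 ∨ ∃ i, x = ConeElt.copy e.1 i := by
    rintro ⟨e, he | ⟨i, he⟩⟩
    · exact ⟨_, he, Or.inl rfl⟩
    · exact ⟨_, he, Or.inr ⟨i, rfl⟩⟩
  choose f hf hf' using h
  have hinj : Function.Injective (fun e => (⟨f e, hf e⟩ : S)) := by
    intro a b hab
    have hab' : f a = f b := congrArg Subtype.val hab
    apply Subtype.ext
    rcases hf' a with ha | ⟨i, ha⟩ <;> rcases hf' b with hb | ⟨j, hb⟩ <;>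
      rw [ha, hb] at hab' <;> injection hab'
  exact (Function.Embedding.encard_le ⟨_, hinj⟩)

/-- Independence in the free cone. -/
def ConeIndep (M : Matroid α) (I : Set (ConeElt α m)) : Prop :=
  I ⊆ coneSet m M.E ∧ M.Indep (ConeElt.base ⁻¹' I) ∧ I.encard ≤ M.eRk (coneProj I) + 1

theorem ConeIndep.subset {M : Matroid α} [M.Finite] {I J : Set (ConeElt α m)}
    (hJ : ConeIndep M J) (hIJ : I ⊆ J) : ConeIndep M I := by
  obtain ⟨h1, h2, h3⟩ := hJ
  refine ⟨hIJ.trans h1, h2.subset (preimage_mono hIJ), ?_⟩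
  have hJfin : J.Finite := (coneSet_finite M.ground_finite).subset h1
  have hle : M.eRk (coneProj J) ≤ M.eRk (coneProj I) + (J \ I).encard := by
    calc M.eRk (coneProj J) = M.eRk (coneProj I ∪ coneProj (J \ I)) := by
          rw [← coneProj_union, union_sdiff_cancel hIJ]
      _ ≤ M.eRk (coneProj I) + (coneProj (J \ I)).encard := eRk_union_le_eRk_add_encard _ _ _
      _ ≤ _ := by gcongr; exact coneProj_encard_le _
  have hc : (J \ I).encard + I.encard = J.encard := encard_sdiff_add_encard_of_subset hIJ
  have hne : (J \ I).encard ≠ ⊤ := (hJfin.subset sdiff_subset).encard_lt_top.ne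
  refine (ENat.add_le_add_iff_left hne).1 ?_
  rw [hc]
  calc J.encard ≤ M.eRk (coneProj J) + 1 := h3
    _ ≤ M.eRk (coneProj I) + (J \ I).encard + 1 := by gcongr
    _ = _ := by ring

theorem ConeIndep.augment {M : Matroid α} [M.Finite] {I J : Set (ConeElt α m)}
    (hI : ConeIndep M I) (hJ : ConeIndep M J) (hlt : I.encard < J.encard) :
    ∃ e ∈ J, e ∉ I ∧ ConeIndep M (insert e I) := by
  have hJfin : J.Finite := (coneSet_finite M.ground_finite).subset hJ.1
  have hIfin : I.Finite := (coneSet_finite M.ground_finite).subset hI.1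
  by_cases hcase : I.encard ≤ M.eRk (coneProj I)
  · have key : ∀ x ∈ J, x ∉ I → M.Indep (ConeElt.base ⁻¹' (insert x I)) →
        ConeIndep M (insert x I) := by
      intro x hxJ hxI hx
      refine ⟨insert_subset (hJ.1 hxJ) hI.1, hx, ?_⟩
      rw [encard_insert_of_notMem hxI]
      gcongr
      exact hcase.trans (M.eRk_mono (coneProj_mono (subset_insert _ _)))
    by_cases hnb : ∃ x ∈ J, x ∉ I ∧ ∀ e, x ≠ ConeElt.base e
    · obtain ⟨x, hxJ, hxI, hx⟩ := hnb
      refine ⟨x, hxJ, hxI, key x hxJ hxI ?_⟩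
      convert hI.2.1 using 1
      ext e
      simp [(hx e).symm]
    · push Not at hnb
      have hsub : J \ I ⊆ ConeElt.base '' (ConeElt.base ⁻¹' (J \ I)) := by
        rintro x ⟨hxJ, hxI⟩
        obtain ⟨e, rfl⟩ := hnb x hxJ hxI
        exact ⟨e, ⟨hxJ, hxI⟩, rfl⟩
      have hcard : (ConeElt.base ⁻¹' I : Set α).encard < (ConeElt.base ⁻¹' J : Set α).encard := by
        have h1 : (I \ J).encard < (J \ I).encard := by
          have e1 := encard_sdiff_add_encard_inter I J
          have e2 := encard_sdiff_add_encard_inter J I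
          rw [inter_comm] at e2
          rw [← e1, ← e2] at hlt
          exact lt_of_add_lt_add_right hlt
        have h2 : (ConeElt.base ⁻¹' (I \ J) : Set α).encard
            < (ConeElt.base ⁻¹' (J \ I) : Set α).encard := by
          rw [← base_injective.encard_image (ConeElt.base ⁻¹' (I \ J)),
            ← base_injective.encard_image (ConeElt.base ⁻¹' (J \ I))]
          exact ((encard_le_encard (image_preimage_subset _ _)).trans_lt h1).trans_le
            (encard_le_encard hsub)
        have e1 := encard_sdiff_add_encard_inter (ConeElt.base ⁻¹' I : Set α) (ConeElt.base ⁻¹' J)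
        have e2 := encard_sdiff_add_encard_inter (ConeElt.base ⁻¹' J : Set α) (ConeElt.base ⁻¹' I)
        rw [inter_comm] at e2
        rw [← e1, ← e2]
        have hne : (ConeElt.base ⁻¹' I ∩ ConeElt.base ⁻¹' J : Set α).encard ≠ ⊤ :=
          ((hIfin.preimage base_injective.injOn).subset inter_subset_left).encard_lt_top.ne
        exact (WithTop.add_lt_add_iff_right hne).2 h2
      obtain ⟨e, he, hins⟩ := hI.2.1.exists_insert_of_encard_lt hJ.2.1 hcard
      refine ⟨ConeElt.base e, he.1, he.2, key _ he.1 he.2 ?_⟩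
      convert hins using 1
      ext e'
      simp
  · push Not at hcase
    have hr : M.eRk (coneProj I) < M.eRk (coneProj J) := by
      have h1 : I.encard + 1 ≤ J.encard := Order.add_one_le_of_lt hlt
      have h2 := h1.trans hJ.2.2
      have h3 : I.encard ≤ M.eRk (coneProj J) := by
        exact (ENat.add_le_add_iff_right (by simp)).1 h2
      exact hcase.trans_le h3
    obtain ⟨e, he, hins⟩ := exists_eRk_insert_eq_add_one_of_lt hr
    have heI : e ∉ coneProj I := he.2
    have hecl : e ∈ M.E \ M.closure (coneProj I) := by
      by_contra hcon
      have heE : e ∈ M.E := by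
        rcases he.1 with h | ⟨i, h⟩
        · exact base_mem_coneSet.1 (hJ.1 h)
        · exact copy_mem_coneSet.1 (hJ.1 h)
      have hec : e ∈ M.closure (coneProj I) := by
        by_contra h
        exact hcon ⟨heE, h⟩
      rw [← eRk_insert_closure_eq, insert_eq_of_mem hec, eRk_closure_eq] at hins
      have : M.eRk (coneProj I) ≠ ⊤ := hcase.ne_top
      exact absurd hins (ENat.lt_add_one_iff this |>.2 le_rfl).ne
    have hfinish : ∀ x ∈ J, e ∈ coneProj ({x} : Set (ConeElt α m)) →
        (∀ e', x = ConeElt.base e' → e' = e) →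
        ∃ e ∈ J, e ∉ I ∧ ConeIndep M (insert e I) := by
      intro x hxJ hxe hxb
      have hxI : x ∉ I := fun h => heI (coneProj_mono (singleton_subset_iff.2 h) hxe)
      refine ⟨x, hxJ, hxI, insert_subset (hJ.1 hxJ) hI.1, ?_, ?_⟩
      · have hsub : (ConeElt.base ⁻¹' (insert x I) : Set α) ⊆ insert e (ConeElt.base ⁻¹' I) := by
          rintro e' (h | h)
          · exact Or.inl (hxb e' h.symm)
          · exact Or.inr h
        refine Indep.subset ?_ hsub
        refine hI.2.1.insert_indep_iff.2 (Or.inl ⟨hecl.1, fun h => hecl.2 ?_⟩)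
        exact M.closure_subset_closure (fun e' h' => Or.inl h') h
      · rw [encard_insert_of_notMem hxI]
        gcongr
        refine hI.2.2.trans ?_
        rw [← hins]
        refine M.eRk_mono ?_
        rw [insert_eq x I, coneProj_union]
        exact insert_subset (Or.inl hxe) subset_union_right
    rcases he.1 with h | ⟨i, h⟩
    · exact hfinish _ h (Or.inl rfl) (by rintro e' h'; injection h' with h'; exact h'.symm)
    · exact hfinish _ h (Or.inr ⟨i, rfl⟩) (by rintro e' h'; cases h')

/-- The free cone through its independent sets. -/
def explicitCone (M : Matroid α) [M.Finite] (m : ℕ) : Matroid (ConeElt α m) :=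
  (IndepMatroid.ofBddAugment (coneSet m M.E) (ConeIndep M)
    (indep_empty := ⟨empty_subset _, by simp, by simp⟩)
    (indep_subset := fun _ _ => ConeIndep.subset)
    (indep_aug := fun _ _ => ConeIndep.augment)
    (indep_bdd := ⟨(coneSet m M.E).ncard, fun I hI => by
      rw [(coneSet_finite M.ground_finite).cast_ncard_eq]
      exact encard_le_encard hI.1⟩)
    (subset_ground := fun _ h => h.1)).matroid

theorem explicitCone_indep_iff {M : Matroid α} [M.Finite] {I : Set (ConeElt α m)} :
    (explicitCone M m).Indep I ↔ ConeIndep M I := Iff.rfl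

theorem explicitCone_ground {M : Matroid α} [M.Finite] :
    (explicitCone M m).E = coneSet m M.E := rfl

theorem base_image_subset {S T : Set α} (h : S ⊆ T) :
    (ConeElt.base '' S : Set (ConeElt α m)) ⊆ coneSet m T := by
  rintro _ ⟨e, he, rfl⟩
  exact base_mem_coneSet.2 (h he)

theorem coneSet_mono {S T : Set α} (h : S ⊆ T) : coneSet m S ⊆ coneSet m T := by
  rintro (e | ⟨e, i⟩ | _) hx
  · exact base_mem_coneSet.2 (h (base_mem_coneSet.1 hx))
  · exact copy_mem_coneSet.2 (h (copy_mem_coneSet.1 hx))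
  · exact tip_mem_coneSet

theorem preimage_base_image (S : Set α) :
    (ConeElt.base ⁻¹' (ConeElt.base '' S : Set (ConeElt α m))) = S :=
  preimage_image_eq _ base_injective

theorem explicitCone_indep_base {M : Matroid α} [M.Finite] {S : Set α} :
    (explicitCone M m).Indep (ConeElt.base '' S) ↔ M.Indep S := by
  refine ⟨fun h => ?_, fun h => ⟨base_image_subset h.subset_ground, ?_, ?_⟩⟩
  · have := h.2.1
    rwa [preimage_base_image] at this
  · rwa [preimage_base_image]
  · rw [coneProj_base_image, base_injective.encard_image, h.eRk_eq_encard]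
    exact le_self_add

theorem explicitCone_indep_insert {M : Matroid α} [M.Finite] {S : Set α} (hS : M.Indep S)
    {x : ConeElt α m} (hx : x ∈ coneSet m M.E) (hxb : ∀ e, x ≠ ConeElt.base e) :
    (explicitCone M m).Indep (insert x (ConeElt.base '' S)) := by
  refine ⟨insert_subset hx (base_image_subset hS.subset_ground), ?_, ?_⟩
  · convert hS using 1
    ext e
    simp [(hxb e).symm]
  · refine (encard_insert_le _ _).trans ?_
    rw [base_injective.encard_image, ← hS.eRk_eq_encard]
    gcongr
    refine M.eRk_mono ?_
    calc S = coneProj (ConeElt.base '' S : Set (ConeElt α m)) := (coneProj_base_image S).symm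
      _ ⊆ _ := coneProj_mono (subset_insert _ _)

theorem isCyclic_iff {β : Type*} {M : Matroid β} {A : Set β} (hA : A ⊆ M.E) :
    M.IsCyclic A ↔ ∀ e ∈ A, ∃ B, M.IsBasis B A ∧ e ∉ B := by
  constructor
  · rintro ⟨-, h⟩ e -
    have := h e
    rw [isColoop_iff_forall_mem_isBase] at this
    push Not at this
    obtain ⟨B, hB, heB⟩ := this
    exact ⟨B, (isBase_restrict_iff hA).1 hB, heB⟩
  · refine fun h => ⟨hA, fun e he => ?_⟩
    obtain ⟨B, hB, heB⟩ := h e he.mem_ground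
    exact heB (isColoop_iff_forall_mem_isBase.1 he ((isBase_restrict_iff hA).2 hB))

theorem isFlat_of_forall {β : Type*} {M : Matroid β} {F : Set β} (hF : F ⊆ M.E)
    (h : ∀ e ∈ M.E, e ∉ F → ∃ I, M.IsBasis I F ∧ M.Indep (insert e I)) : M.IsFlat F := by
  rw [isFlat_iff_closure_eq]
  refine (M.subset_closure F hF).antisymm' fun e he => ?_
  by_contra heF
  obtain ⟨I, hI, hins⟩ := h e (M.closure_subset_ground _ he) heF
  rw [← hI.closure_eq_closure, hI.indep.mem_closure_iff'] at he
  exact heF (hI.subset (he.2 hins))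

theorem IsFlat.mem_of_not_indep {β : Type*} {M : Matroid β} {F I : Set β} (hF : M.IsFlat F)
    (hI : M.Indep I) (hIF : I ⊆ F) {e : β} (he : e ∈ M.E) (hn : ¬ M.Indep (insert e I)) :
    e ∈ F := by
  have : e ∈ M.closure I := (hI.mem_closure_iff').2 ⟨he, fun h => absurd h hn⟩
  rw [← hF.closure]
  exact M.closure_subset_closure hIF this

theorem IsFlat.insert_indep {β : Type*} {M : Matroid β} {F I : Set β} (hF : M.IsFlat F)
    (hI : M.Indep I) (hIF : I ⊆ F) {e : β} (he : e ∈ M.E) (heF : e ∉ F) :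
    M.Indep (insert e I) := by
  by_contra hn
  exact heF (hF.mem_of_not_indep hI hIF he hn)

theorem explicitCone_isBasis_base {M : Matroid α} [M.Finite] {B S : Set α}
    (hB : M.IsBasis B S) :
    (explicitCone M m).IsBasis (ConeElt.base '' B) (ConeElt.base '' S) := by
  refine (explicitCone_indep_base.2 hB.indep).isBasis_of_forall_insert
    (image_mono hB.subset) ?_
  rintro _ ⟨⟨e, he, rfl⟩, heB⟩
  have heB' : e ∉ B := fun h => heB ⟨e, h, rfl⟩
  rw [← image_insert_eq, Dep, explicitCone_indep_base]
  have hd := hB.insert_dep ⟨he, heB'⟩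
  exact ⟨hd.not_indep, base_image_subset hd.subset_ground⟩

theorem explicitCone_isBasis_preimage {M : Matroid α} [M.Finite] {S : Set α} (hS : S ⊆ M.E)
    {I : Set (ConeElt α m)} (hI : (explicitCone M m).IsBasis I (ConeElt.base '' S)) :
    M.IsBasis (ConeElt.base ⁻¹' I) S := by
  have hsub : (ConeElt.base ⁻¹' I : Set α) ⊆ S := by
    rintro e he
    obtain ⟨e', he', h⟩ := hI.subset he
    rwa [← base_injective h]
  have hIe : ConeElt.base '' (ConeElt.base ⁻¹' I : Set α) = I := by
    refine image_preimage_eq_of_subset (hI.subset.trans (image_subset_range _ _))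
  refine Indep.isBasis_of_forall_insert hI.indep.2.1 hsub ?_
  rintro e ⟨he, heI⟩
  have hd := hI.insert_dep ⟨⟨e, he, rfl⟩, heI⟩
  refine ⟨fun hi => hd.not_indep ?_, insert_subset (hS he) (hsub.trans hS)⟩
  rw [← hIe, ← image_insert_eq]
  exact explicitCone_indep_base.2 hi

theorem explicitCone_eRk_base {M : Matroid α} [M.Finite] {S : Set α} (hS : S ⊆ M.E) :
    (explicitCone M m).eRk (ConeElt.base '' S) = M.eRk S := by
  obtain ⟨B, hB⟩ := M.exists_isBasis S
  rw [(explicitCone_isBasis_base hB).eRk_eq_encard, hB.eRk_eq_encard,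
    base_injective.encard_image]

theorem explicitCone_eRk_cone {M : Matroid α} [M.Finite] {S : Set α} (hS : S ⊆ M.E) :
    (explicitCone M m).eRk (coneSet m S) = M.eRk S + 1 := by
  obtain ⟨B, hB⟩ := M.exists_isBasis S
  apply le_antisymm
  · rw [eRk_le_iff]
    intro I hIS hI
    refine hI.2.2.trans ?_
    gcongr
    exact M.eRk_mono ((coneProj_mono hIS).trans (coneProj_coneSet S).subset)
  · have h := explicitCone_indep_insert (m := m) hB.indep (x := ConeElt.tip) tip_mem_coneSet
      (by simp)
    have := h.encard_le_eRk_of_subset (X := coneSet m S)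
      (insert_subset tip_mem_coneSet (base_image_subset hB.subset))
    rwa [encard_insert_of_notMem (by simp), base_injective.encard_image,
      ← hB.eRk_eq_encard] at this

theorem explicitCone_isBasis_cone {M : Matroid α} [M.Finite] {S : Set α} (hS : S ⊆ M.E)
    {I : Set (ConeElt α m)} (hIS : I ⊆ coneSet m S) (hI : M.Indep (ConeElt.base ⁻¹' I))
    (hcard : I.encard = M.eRk S + 1) (hproj : M.eRk S ≤ M.eRk (coneProj I)) :
    (explicitCone M m).IsBasis I (coneSet m S) := by
  have hfin : (coneSet m S).Finite := coneSet_finite (M.ground_finite.subset hS)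
  refine (isBasis_iff_indep_encard_eq_of_finite (hfin.subset hIS) (coneSet_mono hS)).2
    ⟨hIS, ⟨hIS.trans (coneSet_mono hS), hI, ?_⟩, ?_⟩
  · rw [hcard]; gcongr
  · rw [hcard, explicitCone_eRk_cone hS]

theorem explicitCone_isFlat_base {M : Matroid α} [M.Finite] {F : Set α} (hF : M.IsFlat F) :
    (explicitCone M m).IsFlat (ConeElt.base '' F) := by
  obtain ⟨B, hB⟩ := M.exists_isBasis F
  refine isFlat_of_forall (base_image_subset hF.subset_ground) fun x hx hxF => ?_
  refine ⟨_, explicitCone_isBasis_base hB, ?_⟩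
  by_cases hxb : ∀ e, x ≠ ConeElt.base e
  · exact explicitCone_indep_insert hB.indep hx hxb
  · push Not at hxb
    obtain ⟨e, rfl⟩ := hxb
    rw [← image_insert_eq, explicitCone_indep_base]
    exact hF.insert_indep hB.indep hB.subset (base_mem_coneSet.1 hx)
      (fun h => hxF ⟨e, h, rfl⟩)

theorem explicitCone_isFlat_cone {M : Matroid α} [M.Finite] {F : Set α} (hF : M.IsFlat F) :
    (explicitCone M m).IsFlat (coneSet m F) := by
  obtain ⟨B, hB⟩ := M.exists_isBasis F
  refine isFlat_of_forall (coneSet_mono hF.subset_ground) fun x hx hxF => ?_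
  have hbas : (explicitCone M m).IsBasis (insert ConeElt.tip (ConeElt.base '' B))
      (coneSet m F) := by
    refine explicitCone_isBasis_cone hF.subset_ground
      (insert_subset tip_mem_coneSet (base_image_subset hB.subset)) ?_ ?_ ?_
    · convert hB.indep using 1
      ext e; simp
    · rw [encard_insert_of_notMem (by simp), base_injective.encard_image, hB.eRk_eq_encard]
    · rw [← hB.eRk_eq_eRk]
      refine M.eRk_mono fun e he => Or.inl (by simp [he])
  refine ⟨_, hbas, ?_⟩
  have hgen : ∀ e ∈ M.E, e ∉ F → M.Indep (insert e B) := fun e he heF =>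
    hF.insert_indep hB.indep hB.subset he heF
  have hcard : (insert x (insert ConeElt.tip (ConeElt.base '' B))).encard
      ≤ B.encard + 1 + 1 := by
    refine (encard_insert_le _ _).trans ?_
    gcongr
    refine (encard_insert_le _ _).trans ?_
    rw [base_injective.encard_image]
  have hmain : ∀ e ∈ M.E, e ∉ F → e ∈ coneProj ({x} : Set (ConeElt α m)) →
      (∀ e', x = ConeElt.base e' → e' = e) →
      (explicitCone M m).Indep (insert x (insert ConeElt.tip (ConeElt.base '' B))) := by
    intro e he heF hex hxb
    have hi := hgen e he heF
    refine ⟨insert_subset hx (insert_subset tip_mem_coneSet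
      (base_image_subset hB.indep.subset_ground)), hi.subset ?_, ?_⟩
    · rintro e' (h | h | ⟨e'', h, h'⟩)
      · exact Or.inl (hxb e' h.symm)
      · cases h
      · injection h' with h'
        exact Or.inr (h' ▸ h)
    · refine hcard.trans ?_
      gcongr
      rw [← encard_insert_of_notMem (fun h => heF (hB.subset h)), ← hi.eRk_eq_encard]
      refine M.eRk_mono (insert_subset ?_ ?_)
      · exact coneProj_mono (by simp) hex
      · intro e' he'
        exact Or.inl (by simp [he'])
  rcases x with e | ⟨e, i⟩ | _
  · exact hmain e (base_mem_coneSet.1 hx) (fun h => hxF (base_mem_coneSet.2 h)) (Or.inl rfl)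
      (by rintro e' h; injection h with h; exact h.symm)
  · exact hmain e (copy_mem_coneSet.1 hx) (fun h => hxF (copy_mem_coneSet.2 h))
      (Or.inr ⟨i, rfl⟩) (by rintro e' h; cases h)
  · exact absurd tip_mem_coneSet hxF

theorem explicitCone_isCyclic_base {M : Matroid α} [M.Finite] {F : Set α}
    (hF : F ⊆ M.E) :
    (explicitCone M m).IsCyclic (ConeElt.base '' F) ↔ M.IsCyclic F := by
  rw [isCyclic_iff (base_image_subset hF), isCyclic_iff hF]
  constructor
  · intro h e he
    obtain ⟨I, hI, heI⟩ := h _ ⟨e, he, rfl⟩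
    exact ⟨_, explicitCone_isBasis_preimage hF hI, heI⟩
  · rintro h _ ⟨e, he, rfl⟩
    obtain ⟨B, hB, heB⟩ := h e he
    refine ⟨_, explicitCone_isBasis_base hB, ?_⟩
    rintro ⟨e', he', h'⟩
    exact heB (base_injective h' ▸ he')

theorem explicitCone_isCyclic_cone {M : Matroid α} [M.Finite] [M.Loopless] (hm : 1 ≤ m)
    {F : Set α} (hF : F ⊆ M.E) (hne : F.Nonempty) :
    (explicitCone M m).IsCyclic (coneSet m F) := by
  rw [isCyclic_iff (coneSet_mono hF)]
  have hcopyinj : Function.Injective (fun e => (ConeElt.copy e ⟨0, hm⟩ : ConeElt α m)) :=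
    fun _ _ h => by injection h
  intro x hx
  by_cases hxb : ∃ e i, x = ConeElt.copy e i
  · obtain ⟨e, i, rfl⟩ := hxb
    obtain ⟨B, hB⟩ := M.exists_isBasis F
    refine ⟨insert ConeElt.tip (ConeElt.base '' B), ?_, by simp⟩
    refine explicitCone_isBasis_cone hF
      (insert_subset tip_mem_coneSet (base_image_subset hB.subset)) ?_ ?_ ?_
    · convert hB.indep using 1
      ext e; simp
    · rw [encard_insert_of_notMem (by simp), base_injective.encard_image, hB.eRk_eq_encard]
    · rw [← hB.eRk_eq_eRk]
      refine M.eRk_mono fun e he => Or.inl (by simp [he])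
  · by_cases hxt : x = ConeElt.tip
    · subst hxt
      obtain ⟨f, hf⟩ := hne
      have hfi : M.Indep {f} := M.subsingleton_indep subsingleton_singleton
        (singleton_subset_iff.2 (hF hf))
      obtain ⟨B, hB, hfB⟩ := hfi.subset_isBasis_of_subset (singleton_subset_iff.2 hf)
      refine ⟨insert (ConeElt.copy f ⟨0, hm⟩) (ConeElt.base '' B), ?_, by simp⟩
      refine explicitCone_isBasis_cone hF
        (insert_subset (copy_mem_coneSet.2 hf) (base_image_subset hB.subset)) ?_ ?_ ?_
      · convert hB.indep using 1
        ext e; simp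
      · rw [encard_insert_of_notMem (by simp), base_injective.encard_image, hB.eRk_eq_encard]
      · rw [← hB.eRk_eq_eRk]
        refine M.eRk_mono fun e he => Or.inl (by simp [he])
    · obtain ⟨B, hB⟩ := M.exists_isBasis F
      refine ⟨insert ConeElt.tip ((fun e => ConeElt.copy e ⟨0, hm⟩) '' B), ?_, ?_⟩
      · refine explicitCone_isBasis_cone hF (insert_subset tip_mem_coneSet ?_) ?_ ?_ ?_
        · rintro _ ⟨e, he, rfl⟩
          exact copy_mem_coneSet.2 (hB.subset he)
        · convert M.empty_indep using 1
          ext e; simp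
        · rw [encard_insert_of_notMem (by simp), hcopyinj.encard_image, hB.eRk_eq_encard]
        · rw [← hB.eRk_eq_eRk]
          refine M.eRk_mono fun e he => Or.inr ⟨⟨0, hm⟩, by simp [he]⟩
      · rintro (h | ⟨e, he, h⟩)
        · exact hxt h
        · exact hxb ⟨e, _, h.symm⟩

theorem isFlat_preimage_base {M : Matroid α} [M.Finite] {G : Set (ConeElt α m)}
    (hG : (explicitCone M m).IsFlat G) : M.IsFlat (ConeElt.base ⁻¹' G) := by
  have hsub : (ConeElt.base ⁻¹' G : Set α) ⊆ M.E := fun e he =>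
    base_mem_coneSet.1 (hG.subset_ground he)
  refine isFlat_of_forall hsub fun e he heG => ?_
  obtain ⟨B, hB⟩ := M.exists_isBasis (ConeElt.base ⁻¹' G : Set α)
  refine ⟨B, hB, ?_⟩
  rw [← explicitCone_indep_base (m := m), image_insert_eq]
  refine hG.insert_indep (explicitCone_indep_base.2 hB.indep) ?_ (base_mem_coneSet.2 he) heG
  rintro _ ⟨e', he', rfl⟩
  exact hB.subset he'

/-- If a flat contains the tip and one element other than the tip in the cone of `e`, then it
contains the cone of `e`. -/
theorem mem_of_tip_mem {M : Matroid α} [M.Finite] [M.Loopless] {G : Set (ConeElt α m)}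
    (hG : (explicitCone M m).IsFlat G) (ht : ConeElt.tip ∈ G) {e : α} (he : e ∈ M.E)
    {x y : ConeElt α m} (hx : x ∈ G) (hxt : x ≠ ConeElt.tip) (hyt : y ≠ ConeElt.tip)
    (hxe : x ∈ coneSet m {e}) (hye : y ∈ coneSet m {e}) : y ∈ G := by
  by_cases hxy : y = x
  · exact hxy ▸ hx
  have hsub : ∀ z ∈ coneSet m {e}, z ∈ coneSet m M.E := fun z hz =>
    coneSet_mono (singleton_subset_iff.2 he) hz
  have hr : M.eRk {e} = 1 := eRk_singleton_eq he
  refine hG.mem_of_not_indep (I := {x, ConeElt.tip}) ?_ ?_ (hsub _ hye) ?_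
  · have hp : coneProj ({x, ConeElt.tip} : Set (ConeElt α m)) = {e} := by
      rcases x with f | ⟨f, i⟩ | _
      · obtain rfl : f = e := mem_singleton_iff.1 (base_mem_coneSet.1 hxe)
        ext g; simp [coneProj]
      · obtain rfl : f = e := mem_singleton_iff.1 (copy_mem_coneSet.1 hxe)
        ext g; simp only [coneProj, mem_ofPred_eq]; simp [eq_comm]
      · exact absurd rfl hxt
    refine ⟨insert_subset (hsub _ hxe) (by simpa using tip_mem_coneSet), ?_, ?_⟩
    · refine (M.subsingleton_indep (I := {e}) subsingleton_singleton
        (singleton_subset_iff.2 he)).subset ?_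
      exact fun g hg => hp ▸ Or.inl hg
    · rw [hp, hr, encard_pair hxt]; rfl
  · exact insert_subset hx (singleton_subset_iff.2 ht)
  · intro h
    have hc := h.2.2
    have hp : M.eRk (coneProj ({y, x, ConeElt.tip} : Set (ConeElt α m))) ≤ 1 := by
      rw [← hr]
      refine M.eRk_mono ((coneProj_mono (T := coneSet m {e}) ?_).trans
        (coneProj_coneSet _).subset)
      exact insert_subset hye (insert_subset hxe (singleton_subset_iff.2 tip_mem_coneSet))
    have h3 : ({y, x, ConeElt.tip} : Set (ConeElt α m)).encard = 3 := by
      rw [encard_insert_of_notMem (by simp [hxy, hyt]), encard_pair hxt]; rfl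
    rw [h3] at hc
    have := hc.trans (add_le_add_left hp 1)
    exact absurd this (by decide)

theorem explicitCone_isFreeCone (M : Matroid α) [M.Finite] [M.Loopless] (hm : 1 ≤ m) :
    M.IsFreeCone m (explicitCone M m) where
  ground_eq := rfl
  eRk_base F hF := explicitCone_eRk_base hF.1.subset_ground
  eRk_cone F hF _ := explicitCone_eRk_cone hF.subset_ground
  isCyclicFlat_iff G := by
    constructor
    · rintro ⟨hG, hGc⟩
      have hflat := isFlat_preimage_base hG
      have hGE : G ⊆ coneSet m M.E := hG.subset_ground
      have hcyc := (isCyclic_iff hG.subset_ground).1 hGc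
      by_cases ht : ConeElt.tip ∈ G
      · right
        have hG' : G = coneSet m (ConeElt.base ⁻¹' G) := by
          ext x
          rcases x with e | ⟨e, i⟩ | _
          · rw [base_mem_coneSet]; rfl
          · rw [copy_mem_coneSet]
            constructor
            · intro h
              exact mem_of_tip_mem hG ht (copy_mem_coneSet.1 (hGE h)) h (by simp) (by simp)
                (copy_mem_coneSet.2 rfl) (base_mem_coneSet.2 rfl)
            · intro h
              exact mem_of_tip_mem hG ht (base_mem_coneSet.1 (hGE h)) h (by simp) (by simp)
                (base_mem_coneSet.2 rfl) (copy_mem_coneSet.2 rfl)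
          · exact ⟨fun _ => tip_mem_coneSet, fun _ => ht⟩
        refine ⟨_, hflat, ?_, hG'⟩
        by_contra hem
        rw [not_nonempty_iff_eq_empty] at hem
        obtain ⟨B, hB, htB⟩ := hcyc _ ht
        rw [hem] at hG'
        have hB0 : B = ∅ := by
          rw [eq_empty_iff_forall_notMem]
          intro x hx
          have hx' := hB.subset hx
          rw [hG'] at hx'
          rcases x with e | ⟨e, i⟩ | _
          · exact base_mem_coneSet.1 hx'
          · exact copy_mem_coneSet.1 hx'
          · exact htB hx
        have hd := hB.insert_dep ⟨ht, htB⟩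
        rw [hB0] at hd
        refine hd.not_indep ?_
        have := explicitCone_indep_insert (m := m) M.empty_indep (x := ConeElt.tip)
          tip_mem_coneSet (by simp)
        simpa using this
      · left
        have hG' : G = ConeElt.base '' (ConeElt.base ⁻¹' G) := by
          refine (image_preimage_eq_of_subset fun x hx => ?_).symm
          rcases x with e | ⟨e, i⟩ | _
          · exact ⟨e, rfl⟩
          · exfalso
            obtain ⟨B, hB, hxB⟩ := hcyc _ hx
            refine (hB.insert_dep ⟨hx, hxB⟩).not_indep ?_
            have h1 := hG.insert_indep hB.indep hB.subset
              (show ConeElt.tip ∈ (explicitCone M m).E from tip_mem_coneSet) ht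
            have hpt : coneProj (insert ConeElt.tip B) = coneProj B := by
              ext e; simp [coneProj]
            have hle : B.encard ≤ M.eRk (coneProj B) := by
              have := h1.2.2
              rw [encard_insert_of_notMem (fun h => ht (hB.subset h)), hpt] at this
              exact (ENat.add_le_add_iff_right (by simp)).1 this
            refine ⟨insert_subset (hGE hx) hB.indep.1, ?_, ?_⟩
            · convert hB.indep.2.1 using 1
              ext e'; simp
            · refine (encard_insert_le _ _).trans ?_
              gcongr
              exact hle.trans (M.eRk_mono (coneProj_mono (subset_insert _ _)))
          · exact absurd hx ht
        refine ⟨_, ⟨hflat, ?_⟩, hG'⟩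
        rw [hG'] at hGc
        exact (explicitCone_isCyclic_base hflat.subset_ground).1 hGc
    · rintro (⟨F, ⟨hF, hFc⟩, rfl⟩ | ⟨F, hF, hne, rfl⟩)
      · exact ⟨explicitCone_isFlat_base hF, (explicitCone_isCyclic_base hF.subset_ground).2 hFc⟩
      · exact ⟨explicitCone_isFlat_cone hF, explicitCone_isCyclic_cone hm hF.subset_ground hne⟩

/-- A finite matroid is determined by its ground set, its cyclic flats, and their ranks. -/
theorem indep_of_forall_cyclicFlat {β : Type*} {P Q : Matroid β} [P.Finite]
    (hE : P.E = Q.E) (hZ : ∀ Z, P.IsCyclicFlat Z → Q.eRk Z = P.eRk Z) {I : Set β}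
    (hI : Q.Indep I) : P.Indep I := by
  by_contra hn
  have hIE : I ⊆ P.E := hE ▸ hI.subset_ground
  obtain ⟨C, hCI, hC⟩ := (P.not_indep_iff hIE |>.1 hn).exists_isCircuit_subset
  have hCE := hC.subset_ground
  have hcf : P.IsCyclicFlat (P.closure C) := by
    refine ⟨P.isFlat_closure C, (isCyclic_iff (P.closure_subset_ground C)).2 fun e he => ?_⟩
    by_cases heC : e ∈ C
    · exact ⟨C \ {e}, (hC.sdiff_singleton_isBasis heC).isBasis_closure_right, by simp⟩
    · obtain ⟨f, hf⟩ := hC.nonempty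
      exact ⟨C \ {f}, (hC.sdiff_singleton_isBasis hf).isBasis_closure_right,
        fun h => heC h.1⟩
  have h1 := hZ _ hcf
  rw [eRk_closure_eq] at h1
  have h2 := (hI.subset hCI).encard_le_eRk_of_subset (P.subset_closure C hCE)
  rw [h1, ← hC.eRk_add_one_eq] at h2
  have hfin : P.eRk C ≠ ⊤ := ((P.eRk_le_encard C).trans_lt
    (P.ground_finite.subset hCE).encard_lt_top).ne
  exact absurd h2 (not_le.2 ((ENat.lt_add_one_iff hfin).2 le_rfl))

theorem existsUnique_isFreeCone (M : Matroid α) [M.Finite] [M.Loopless] (hm : 1 ≤ m) :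
    ∃! Q : Matroid (ConeElt α m), M.IsFreeCone m Q := by
  refine ⟨explicitCone M m, explicitCone_isFreeCone M hm, fun Q hQ => ?_⟩
  have hP := explicitCone_isFreeCone M hm
  have : Q.Finite := ⟨by rw [hQ.ground_eq]; exact coneSet_finite M.ground_finite⟩
  have : (explicitCone M m).Finite := ⟨coneSet_finite M.ground_finite⟩
  have hrk : ∀ Z, Q.IsCyclicFlat Z → (explicitCone M m).eRk Z = Q.eRk Z := by
    intro Z hZ
    rcases (hQ.isCyclicFlat_iff Z).1 hZ with ⟨F, hF, rfl⟩ | ⟨F, hF, hne, rfl⟩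
    · rw [hQ.eRk_base F hF, hP.eRk_base F hF]
    · rw [hQ.eRk_cone F hF hne, hP.eRk_cone F hF hne]
  refine ext_indep (hQ.ground_eq.trans hP.ground_eq.symm) fun I _ => ⟨fun h => ?_, fun h => ?_⟩
  · refine indep_of_forall_cyclicFlat (hP.ground_eq.trans hQ.ground_eq.symm)
      (fun Z hZ => (hrk Z ?_).symm) h
    exact (hQ.isCyclicFlat_iff Z).2 ((hP.isCyclicFlat_iff Z).1 hZ)
  · exact indep_of_forall_cyclicFlat (hQ.ground_eq.trans hP.ground_eq.symm) hrk h

end Existence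

/-- The free `m`-cone `Q_m(M)` of a finite loopless matroid `M`, for `m ≥ 1`: the matroid on
`E ∪ T ∪ {a}` with the prescribed cyclic flats and ranks of cyclic flats. -/
noncomputable def freeCone {α : Type*} (M : Matroid α) [M.Finite] [M.Loopless] (m : ℕ)
    (hm : 1 ≤ m) : Matroid (ConeElt α m) :=
  (existsUnique_isFreeCone M hm).choose

theorem isFreeCone_freeCone {α : Type*} (M : Matroid α) [M.Finite] [M.Loopless] (m : ℕ)
    (hm : 1 ≤ m) : M.IsFreeCone m (M.freeCone m hm) :=
  (existsUnique_isFreeCone M hm).choose_spec.1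

/-- The tipless `m`-cone `Q ∖ a`. -/
noncomputable def tiplessCone {α : Type*} (M : Matroid α) [M.Finite] [M.Loopless] (m : ℕ)
    (hm : 1 ≤ m) : Matroid (ConeElt α m) :=
  M.freeCone m hm ＼ {ConeElt.tip}

/-- The baseless `m`-cone `Q ∖ E`. -/
noncomputable def baselessCone {α : Type*} (M : Matroid α) [M.Finite] [M.Loopless] (m : ℕ)
    (hm : 1 ≤ m) : Matroid (ConeElt α m) :=
  M.freeCone m hm ＼ (ConeElt.base '' M.E)

/-- The tipless baseless `m`-cone `Q ∖ (E ∪ a)`. -/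
noncomputable def tiplessBaselessCone {α : Type*} (M : Matroid α) [M.Finite] [M.Loopless]
    (m : ℕ) (hm : 1 ≤ m) : Matroid (ConeElt α m) :=
  M.freeCone m hm ＼ (ConeElt.base '' M.E ∪ {ConeElt.tip})

end Matroid

/-!
A loopless matroid is determined by the ordered set of its nonempty flats together with the sizes
of its points (`isIsomorphic_of_orderIso`), and the cones of the nonempty flats form a copy of
this ordered set among the cyclic flats of the free cone.

A cyclic flat of a deletion `Q ＼ D` is the trace of a cyclic flat of `Q`, and conversely the trace
of the cone of `F` is cyclic if each `e ∈ F` keeps at least three elements of its own cone, which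
is a line without parallel elements. This is what the bounds on `m` are for. If `E` is deleted, the
only cyclic flat left besides the cones is the empty set, so that the cones are the cyclic flats of
positive size, and their sizes give those of the flats.

In the tipless cone, the cyclic flats of `M` survive as well, and the configuration does not say
which of its elements are cones. If two descriptions of it, over `M` and over `N`, agree on this,
then a point of several elements is the cyclic flat of `M` below its cone, so that the sizes of the
points are known without knowing `m`. They may disagree: for `M = U_{2,m+1}` the cyclic flat `E` can
be exchanged with the cone of a point. Assume that the cone of some flat of `M` is also a cyclic
flat of `N`. A largest such cone belongs to a hyperplane `H` of `M` and is the ground set of `N`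
(`exists_hyperplane`). The points outside `H` are then single elements, more than one by counting,
and any two of them are collinear with each element of `H` (`mem_closure_pair_of_swap`), so that `M`
is a line and `H` one of its points. The ground set of `M` is in turn the cone of a point of `N`.
Comparing sizes shows that both lines have the same number of elements outside the special point,
which has the same size in both (`isIsomorphic_of_swap`).
-/

namespace Matroid

open Set

/-! ### Cyclic flats of deletions -/

theorem isCyclic_of_forall_mem_closure {β : Type*} {M : Matroid β} {A : Set β} (hA : A ⊆ M.E)
    (h : ∀ e ∈ A, e ∈ M.closure (A \ {e})) : M.IsCyclic A := by
  refine (isCyclic_iff hA).2 fun e he => ?_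
  obtain ⟨B, hB⟩ := M.exists_isBasis (A \ {e}) (sdiff_subset.trans hA)
  refine ⟨B, ?_, fun heB => (hB.subset heB).2 rfl⟩
  refine hB.indep.isBasis_of_subset_of_subset_closure (hB.subset.trans sdiff_subset) ?_
  rw [hB.closure_eq_closure]
  intro x hx
  by_cases hxe : x = e
  · exact hxe ▸ h e he
  · exact M.mem_closure_of_mem ⟨hx, hxe⟩ (sdiff_subset.trans hA)

theorem IsCyclic.closure {β : Type*} {M : Matroid β} {A : Set β} (hA : M.IsCyclic A) :
    M.IsCyclic (M.closure A) := by
  refine (isCyclic_iff (M.closure_subset_ground A)).2 fun e _ => ?_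
  by_cases heA : e ∈ A
  · obtain ⟨B, hB, heB⟩ := (isCyclic_iff hA.1).1 hA e heA
    exact ⟨B, hB.isBasis_closure_right, heB⟩
  · obtain ⟨B, hB⟩ := M.exists_isBasis A hA.1
    exact ⟨B, hB.isBasis_closure_right, fun h => heA (hB.subset h)⟩

theorem isCyclic_delete_iff {β : Type*} {M : Matroid β} {A D : Set β} :
    (M ＼ D).IsCyclic A ↔ M.IsCyclic A ∧ Disjoint A D := by
  constructor
  · intro h
    have hd := subset_sdiff.1 h.1
    refine ⟨(isCyclic_iff hd.1).2 fun e he => ?_, hd.2⟩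
    obtain ⟨B, hB, heB⟩ := (isCyclic_iff h.1).1 h e he
    exact ⟨B, (delete_isBasis_iff.1 hB).1, heB⟩
  · rintro ⟨h, hd⟩
    refine (isCyclic_iff (subset_sdiff.2 ⟨h.1, hd⟩)).2 fun e he => ?_
    obtain ⟨B, hB, heB⟩ := (isCyclic_iff h.1).1 h e he
    exact ⟨B, delete_isBasis_iff.2 ⟨hB, hd⟩, heB⟩

theorem IsFlat.delete {β : Type*} {M : Matroid β} {F : Set β} (hF : M.IsFlat F) (D : Set β) :
    (M ＼ D).IsFlat (F \ D) := by
  rw [isFlat_iff_closure_eq, delete_closure_eq]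
  refine Subset.antisymm ?_ ?_
  · exact sdiff_subset_sdiff_left
      ((M.closure_subset_closure (sdiff_subset.trans sdiff_subset)).trans hF.closure.subset)
  · refine fun x hx => ⟨M.mem_closure_of_mem ⟨hx, hx.2⟩ ?_, hx.2⟩
    exact (sdiff_subset.trans sdiff_subset).trans hF.subset_ground

/-- Every cyclic flat of a deletion is the trace of a cyclic flat of the whole matroid, namely of
its closure. -/
theorem IsCyclicFlat.exists_of_delete {β : Type*} {M : Matroid β} {Z D : Set β}
    (hZ : (M ＼ D).IsCyclicFlat Z) :
    M.IsCyclicFlat (M.closure Z) ∧ Z = M.closure Z \ D := by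
  obtain ⟨hc, hd⟩ := isCyclic_delete_iff.1 hZ.2
  refine ⟨⟨M.isFlat_closure Z, hc.closure⟩, ?_⟩
  have := hZ.1.closure
  rw [delete_closure_eq, hd.sdiff_eq_left] at this
  exact this.symm

theorem isCyclicFlat_empty {β : Type*} (M : Matroid β) [M.Loopless] : M.IsCyclicFlat ∅ :=
  ⟨isFlat_iff_closure_eq.2 M.loops_eq_empty, empty_subset _, fun _ he =>
    absurd he.mem_ground (notMem_empty _)⟩

/-! ### Cyclic flats of the three deletions of the cone -/

section Cone

variable {α : Type*} {m : ℕ} {M : Matroid α} [M.Finite] [M.Loopless]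

theorem freeCone_eq_explicitCone (hm : 1 ≤ m) : M.freeCone m hm = explicitCone M m :=
  (existsUnique_isFreeCone M hm).unique (isFreeCone_freeCone M m hm)
    (explicitCone_isFreeCone M hm)

theorem coneSet_sdiff_subset_iff {F G : Set α} {D : Set (ConeElt α m)}
    (hD : ∀ e ∈ F, ((coneSet m {e} \ {ConeElt.tip}) \ D).Nonempty) :
    coneSet m F \ D ⊆ coneSet m G \ D ↔ F ⊆ G := by
  refine ⟨fun h e he => ?_, fun h => sdiff_subset_sdiff_left (coneSet_mono h)⟩
  obtain ⟨x, ⟨hx, hxt⟩, hxD⟩ := hD e he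
  have := (h ⟨coneSet_mono (singleton_subset_iff.2 he) hx, hxD⟩).1
  rcases x with f | ⟨f, i⟩ | _
  · obtain rfl : f = e := mem_singleton_iff.1 (base_mem_coneSet.1 hx)
    exact base_mem_coneSet.1 this
  · obtain rfl : f = e := mem_singleton_iff.1 (copy_mem_coneSet.1 hx)
    exact copy_mem_coneSet.1 this
  · exact absurd rfl hxt

/-- The cone of a single element is a line on which every two elements span: it has rank two,
and it has no parallel elements because `M` is loopless. -/
theorem mem_closure_pair_of_mem_coneSet_singleton {e : α} (he : e ∈ M.E) {x y z : ConeElt α m}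
    (hx : x ∈ coneSet m {e}) (hy : y ∈ coneSet m {e}) (hz : z ∈ coneSet m {e})
    (hyz : y ≠ z) : x ∈ (explicitCone M m).closure {y, z} := by
  wlog hyt : y ≠ ConeElt.tip generalizing y z
  · rw [pair_comm]
    exact this hz hy hyz.symm fun h => hyz (by rw [h, not_not.1 hyt])
  have hsub : coneSet m {e} ⊆ coneSet m M.E := coneSet_mono (singleton_subset_iff.2 he)
  have hpair : {y, z} ⊆ coneSet m {e} := insert_subset hy (singleton_subset_iff.2 hz)
  have hflat := (explicitCone M m).isFlat_closure {y, z}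
  have hr : M.eRk {e} = 1 := eRk_singleton_eq he
  have hp : coneProj ({y, z} : Set (ConeElt α m)) = {e} := by
    refine ((coneProj_mono hpair).trans (coneProj_coneSet _).subset).antisymm
      (singleton_subset_iff.2 ?_)
    rcases y with f | ⟨f, i⟩ | _
    · obtain rfl : f = e := mem_singleton_iff.1 (base_mem_coneSet.1 hy)
      exact Or.inl (by simp)
    · obtain rfl : f = e := mem_singleton_iff.1 (copy_mem_coneSet.1 hy)
      exact Or.inr ⟨i, by simp⟩
    · exact absurd rfl hyt
  by_cases hxyz : x ∈ ({y, z} : Set (ConeElt α m))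
  · exact (explicitCone M m).mem_closure_of_mem hxyz (hpair.trans hsub)
  refine hflat.mem_of_not_indep (I := {y, z}) ?_
    ((explicitCone M m).subset_closure _ (hpair.trans hsub)) (hsub hx) ?_
  · refine ⟨hpair.trans hsub, ?_, ?_⟩
    · refine (M.subsingleton_indep (I := {e}) subsingleton_singleton
        (singleton_subset_iff.2 he)).subset ?_
      exact fun g hg => hp ▸ Or.inl hg
    · rw [hp, hr, encard_pair hyz]; rfl
  · intro h
    have hc := h.2.2
    rw [encard_insert_of_notMem hxyz, encard_pair hyz] at hc
    have hp' : M.eRk (coneProj (insert x {y, z} : Set (ConeElt α m))) ≤ 1 := by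
      rw [← hr]
      exact M.eRk_mono ((coneProj_mono (insert_subset hx hpair)).trans
        (coneProj_coneSet _).subset)
    have := hc.trans (add_le_add_left hp' 1)
    exact absurd this (by decide)

/-- An element of the cone of `e` is spanned by what a deletion leaves of that cone, even
without the element itself, if the deletion leaves at least three elements. -/
theorem mem_closure_sdiff_of_mem_coneSet {F : Set α} {D : Set (ConeElt α m)} (hF : F ⊆ M.E)
    {e : α} (he : e ∈ F) (h3 : 3 ≤ (coneSet m {e} \ D).encard) {x : ConeElt α m}
    (hx : x ∈ coneSet m {e}) :
    x ∈ (explicitCone M m).closure ((coneSet m F \ D) \ {x}) := by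
  have h2 : 1 < ((coneSet m {e} \ D) \ {x}).encard := by
    by_contra! hcon
    have h4 := h3.trans (encard_le_encard_sdiff_add_encard _ {x})
    rw [encard_singleton] at h4
    exact absurd (h4.trans (add_le_add_left hcon 1)) (by decide)
  obtain ⟨y, z, hy, hz, hyz⟩ := one_lt_encard_iff.1 h2
  have hsub : (coneSet m {e} \ D) \ {x} ⊆ (coneSet m F \ D) \ {x} :=
    sdiff_subset_sdiff_left (sdiff_subset_sdiff_left (coneSet_mono (singleton_subset_iff.2 he)))
  refine (explicitCone M m).closure_subset_closure ?_
    (mem_closure_pair_of_mem_coneSet_singleton (hF he) hx hy.1.1 hz.1.1 hyz)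
  exact insert_subset (hsub hy) (singleton_subset_iff.2 (hsub hz))

theorem exists_mem_coneSet_singleton {F : Set α} (hne : F.Nonempty) {x : ConeElt α m}
    (hx : x ∈ coneSet m F) : ∃ e ∈ F, x ∈ coneSet m {e} := by
  rcases x with e | ⟨e, i⟩ | _
  · exact ⟨e, base_mem_coneSet.1 hx, base_mem_coneSet.2 rfl⟩
  · exact ⟨e, copy_mem_coneSet.1 hx, copy_mem_coneSet.2 rfl⟩
  · exact ⟨_, hne.some_mem, tip_mem_coneSet⟩

theorem isCyclicFlat_coneSet_sdiff {F : Set α} {D : Set (ConeElt α m)}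
    (h3 : ∀ e ∈ F, 3 ≤ (coneSet m {e} \ D).encard) (hF : M.IsFlat F) (hne : F.Nonempty) :
    (explicitCone M m ＼ D).IsCyclicFlat (coneSet m F \ D) := by
  refine ⟨(explicitCone_isFlat_cone hF).delete D, isCyclic_delete_iff.2 ⟨?_, disjoint_sdiff_left⟩⟩
  refine isCyclic_of_forall_mem_closure
    (sdiff_subset.trans (coneSet_mono hF.subset_ground)) fun x hx => ?_
  obtain ⟨e, he, hxe⟩ := exists_mem_coneSet_singleton hne hx.1
  exact mem_closure_sdiff_of_mem_coneSet hF.subset_ground he (h3 e he) hxe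

theorem eRk_coneSet_sdiff {F : Set α} {D : Set (ConeElt α m)}
    (h3 : ∀ e ∈ F, 3 ≤ (coneSet m {e} \ D).encard) (hF : M.IsFlat F) (hne : F.Nonempty) :
    (explicitCone M m ＼ D).eRk (coneSet m F \ D) = M.eRk F + 1 := by
  have hcl : coneSet m F ⊆ (explicitCone M m).closure (coneSet m F \ D) := by
    intro x hx
    obtain ⟨e, he, hxe⟩ := exists_mem_coneSet_singleton hne hx
    exact (explicitCone M m).closure_subset_closure sdiff_subset
      (mem_closure_sdiff_of_mem_coneSet hF.subset_ground he (h3 e he) hxe)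
  rw [← explicitCone_eRk_cone (m := m) hF.subset_ground, ← restrict_compl,
    explicitCone_ground,
    restrict_eRk_eq _ (sdiff_subset_sdiff_left (coneSet_mono hF.subset_ground))]
  refine ((explicitCone M m).eRk_mono sdiff_subset).antisymm ?_
  rw [← eRk_closure_eq _ (coneSet m F \ D)]
  exact (explicitCone M m).eRk_mono hcl

theorem isCyclicFlat_delete_cases (hm : 1 ≤ m) {Z D : Set (ConeElt α m)}
    (hZ : (explicitCone M m ＼ D).IsCyclicFlat Z) :
    (∃ F, M.IsCyclicFlat F ∧ Z = ConeElt.base '' F \ D) ∨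
      ∃ F, M.IsFlat F ∧ F.Nonempty ∧ Z = coneSet m F \ D := by
  obtain ⟨h1, h2⟩ := hZ.exists_of_delete
  rcases ((explicitCone_isFreeCone M hm).isCyclicFlat_iff _).1 h1 with ⟨F, hF, h⟩ | ⟨F, hF, hne, h⟩
  · exact Or.inl ⟨F, hF, by rw [← h]; exact h2⟩
  · exact Or.inr ⟨F, hF, hne, by rw [← h]; exact h2⟩

/-- The copies of the elements of `S`. -/
def copySet (m : ℕ) (S : Set α) : Set (ConeElt α m) :=
  (fun p : α × Fin m => ConeElt.copy p.1 p.2) '' (S ×ˢ univ)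

theorem encard_copySet (S : Set α) : (copySet m S).encard = m * S.encard := by
  rw [copySet, Function.Injective.encard_image, encard_prod, encard_univ,
    ENat.card_eq_coe_fintype_card, Fintype.card_fin, mul_comm]
  rintro ⟨e, i⟩ ⟨f, j⟩ h
  injection h with h1 h2
  exact Prod.ext h1 h2

theorem mem_copySet {S : Set α} {e : α} {i : Fin m} : ConeElt.copy e i ∈ copySet m S ↔ e ∈ S := by
  simp [copySet]

theorem coneSet_sdiff_base_tip {S E : Set α} (hS : S ⊆ E) :
    coneSet m S \ (ConeElt.base '' E ∪ {ConeElt.tip}) = copySet m S := by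
  ext (e | ⟨e, i⟩ | _)
  · simp only [mem_sdiff, base_mem_coneSet, copySet]; simp; exact fun h => hS h
  · simp [copy_mem_coneSet, mem_copySet]
  · simp [copySet]

theorem coneSet_sdiff_base {S E : Set α} (hS : S ⊆ E) :
    coneSet m S \ ConeElt.base '' E = insert ConeElt.tip (copySet m S) := by
  ext (e | ⟨e, i⟩ | _)
  · simp only [mem_sdiff, base_mem_coneSet, copySet]; simp; exact fun h => hS h
  · simp [copy_mem_coneSet, mem_copySet]
  · simp [tip_mem_coneSet]

theorem coneSet_sdiff_tip {S : Set α} :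
    coneSet m S \ {ConeElt.tip} = ConeElt.base '' S ∪ copySet m S := by
  ext (e | ⟨e, i⟩ | _)
  · simp [base_mem_coneSet, copySet]
  · simp [copy_mem_coneSet, mem_copySet]
  · simp [copySet]

theorem encard_coneSet_sdiff_base {S E : Set α} (hS : S ⊆ E) :
    (coneSet m S \ ConeElt.base '' E).encard = m * S.encard + 1 := by
  rw [coneSet_sdiff_base hS, encard_insert_of_notMem (by simp [copySet]), encard_copySet]

theorem encard_coneSet_sdiff_tip {S : Set α} :
    (coneSet m S \ {ConeElt.tip}).encard = (m + 1) * S.encard := by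
  rw [coneSet_sdiff_tip, encard_union_eq, encard_copySet, base_injective.encard_image]
  · ring
  · rw [disjoint_left]
    rintro _ ⟨e, _, rfl⟩
    simp [copySet]

theorem sdiff_tip_sdiff_nonempty (hm : 1 ≤ m) {E : Set α} {D : Set (ConeElt α m)}
    (hD : D ⊆ ConeElt.base '' E ∪ {ConeElt.tip}) (e : α) :
    ((coneSet m {e} \ {ConeElt.tip}) \ D).Nonempty :=
  ⟨ConeElt.copy e ⟨0, hm⟩, ⟨copy_mem_coneSet.2 rfl, by simp⟩, fun h => by simpa using hD h⟩

end Cone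

/-! ### Recovering a matroid from its flats -/

variable {α β : Type*} {M : Matroid α} {N : Matroid β}

/-- The nonempty flats of `M`, ordered by inclusion. -/
abbrev NonemptyFlat (M : Matroid α) : Type _ := {F : Set α // M.IsFlat F ∧ F.Nonempty}

theorem IsIsomorphic.symm (h : M.IsIsomorphic N) : N.IsIsomorphic M := by
  obtain ⟨f, hf⟩ := h
  refine ⟨f.symm, fun I => ?_⟩
  rw [hf, f.image_symm_image]

theorem indep_image_of_flats (f : M.E ≃ N.E)
    (hf : ∀ F, M.IsFlat F → ∃ G, N.IsFlat G ∧ ∀ e : M.E, e.1 ∈ F ↔ (f e).1 ∈ G) {I : Set M.E}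
    (hI : M.Indep (Subtype.val '' I)) : N.Indep (Subtype.val '' (f '' I)) := by
  rw [indep_iff_forall_notMem_closure_sdiff (by rintro _ ⟨x, -, rfl⟩; exact x.2)]
  rintro _ ⟨_, ⟨e, he, rfl⟩, rfl⟩ hcl
  obtain ⟨G, hG, hfG⟩ := hf _ (M.isFlat_closure (Subtype.val '' I \ {e.1}))
  have heI := hI.notMem_closure_sdiff_of_mem ⟨e, he, rfl⟩
  rw [hfG] at heI
  refine heI (hG.closure.subset (N.closure_subset_closure ?_ hcl))
  rintro _ ⟨⟨_, ⟨x, hx, rfl⟩, rfl⟩, hxe⟩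
  refine (hfG x).1 (M.mem_closure_of_mem ⟨⟨x, hx, rfl⟩, fun h => hxe ?_⟩
    (sdiff_subset.trans (by rintro _ ⟨x, -, rfl⟩; exact x.2)))
  rw [Subtype.ext (mem_singleton_iff.1 h)]; rfl

theorem isIsomorphic_of_flats (f : M.E ≃ N.E)
    (hf : ∀ F, M.IsFlat F → ∃ G, N.IsFlat G ∧ ∀ e : M.E, e.1 ∈ F ↔ (f e).1 ∈ G)
    (hf' : ∀ G, N.IsFlat G → ∃ F, M.IsFlat F ∧ ∀ e : M.E, e.1 ∈ F ↔ (f e).1 ∈ G) :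
    M.IsIsomorphic N := by
  refine ⟨f, fun I => ⟨indep_image_of_flats f hf, fun h => ?_⟩⟩
  have := indep_image_of_flats f.symm (fun G hG => ?_) h
  · rwa [f.symm_image_image] at this
  · obtain ⟨F, hF, hFG⟩ := hf' G hG
    exact ⟨F, hF, fun e => by rw [hFG, f.apply_symm_apply]⟩

theorem mem_closure_singleton_self {e : α} (he : e ∈ M.E) : e ∈ M.closure {e} :=
  M.mem_closure_of_mem rfl (singleton_subset_iff.2 he)

/-- In a loopless matroid, a point is spanned by each of its elements. -/
theorem closure_singleton_eq_of_mem [M.Loopless] {e f : α} (he : e ∈ M.E)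
    (hf : f ∈ M.closure {e}) : M.closure {f} = M.closure {e} := by
  refine Subset.antisymm ?_ ?_
  · exact (M.closure_subset_closure_iff_subset_closure
      (singleton_subset_iff.2 (M.mem_ground_of_mem_closure hf))).2 (singleton_subset_iff.2 hf)
  · refine (M.closure_subset_closure_iff_subset_closure (singleton_subset_iff.2 he)).2
      (singleton_subset_iff.2 ?_)
    have h0 : f ∉ M.closure ∅ := by
      rw [show M.closure ∅ = ∅ from M.loops_eq_empty]; exact notMem_empty _
    have := M.mem_closure_insert h0 (by simpa using hf)
    simpa using this

/-- The point spanned by an element of a loopless matroid. -/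
def pointOf (M : Matroid α) (e : M.E) : M.NonemptyFlat :=
  ⟨M.closure {e.1}, M.isFlat_closure _, e.1, mem_closure_singleton_self e.2⟩

theorem pointOf_le_iff {e : M.E} {F : M.NonemptyFlat} : M.pointOf e ≤ F ↔ e.1 ∈ F.1 := by
  refine ⟨fun h => h (mem_closure_singleton_self e.2), fun h => ?_⟩
  exact (M.closure_subset_closure (singleton_subset_iff.2 h)).trans F.2.1.closure.subset

theorem isMin_pointOf [M.Loopless] (e : M.E) : IsMin (M.pointOf e) := by
  intro F hF
  obtain ⟨f, hf⟩ := F.2.2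
  change M.closure {e.1} ⊆ F.1
  rw [← closure_singleton_eq_of_mem e.2 (hF hf)]
  exact (M.closure_subset_closure (singleton_subset_iff.2 hf)).trans F.2.1.closure.subset

theorem pointOf_eq_iff_of_isMin {e : M.E} {P : M.NonemptyFlat} (hP : IsMin P) :
    M.pointOf e = P ↔ e.1 ∈ P.1 := by
  rw [← pointOf_le_iff]
  exact ⟨le_of_eq, fun h => hP.eq_of_le h⟩

theorem eRk_eq_one_of_isMin [M.Loopless] {P : M.NonemptyFlat} (hP : IsMin P) :
    M.eRk P.1 = 1 := by
  obtain ⟨e, he⟩ := P.2.2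
  have heE := P.2.1.subset_ground he
  rw [← (pointOf_eq_iff_of_isMin (e := ⟨e, heE⟩) hP).2 he]
  exact (M.eRk_closure_eq _).trans (eRk_singleton_eq heE)

/-- A loopless matroid is determined by the ordered set of its nonempty flats and the number of
elements in each of its points: its elements can be matched point by point. -/
theorem isIsomorphic_of_orderIso [M.Finite] [N.Finite] [M.Loopless] [N.Loopless]
    (θ : M.NonemptyFlat ≃o N.NonemptyFlat)
    (hθ : ∀ P, IsMin P → P.1.ncard = (θ P).1.ncard) : M.IsIsomorphic N := by
  have hfib : ∀ P : N.NonemptyFlat,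
      Nonempty ({e : M.E // θ (M.pointOf e) = P} ≃ {e : N.E // N.pointOf e = P}) := by
    intro P
    by_cases hP : IsMin P
    · have hP' : IsMin (θ.symm P) := θ.symm.isMin_apply.2 hP
      have h1 : {e : M.E // θ (M.pointOf e) = P} ≃ (θ.symm P).1 :=
        (Equiv.subtypeEquivRight fun e => by
          rw [← pointOf_eq_iff_of_isMin hP']
          exact θ.toEquiv.eq_symm_apply.symm).trans
        (Equiv.subtypeSubtypeEquivSubtype fun h => (θ.symm P).2.1.subset_ground h)
      have h2 : {e : N.E // N.pointOf e = P} ≃ P.1 :=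
        (Equiv.subtypeEquivRight fun e => pointOf_eq_iff_of_isMin hP).trans
        (Equiv.subtypeSubtypeEquivSubtype fun h => P.2.1.subset_ground h)
      have : Finite (θ.symm P).1 := M.ground_finite.subset (θ.symm P).2.1.subset_ground
      have : Finite P.1 := N.ground_finite.subset P.2.1.subset_ground
      have hcard := hθ _ hP'
      rw [θ.apply_symm_apply] at hcard
      exact ⟨h1.trans
        (((Finite.equivFinOfCardEq hcard).trans (Finite.equivFin _).symm).trans h2.symm)⟩
    · have h1 : IsEmpty {e : M.E // θ (M.pointOf e) = P} :=
        ⟨fun e => hP (e.2 ▸ θ.isMin_apply.2 (isMin_pointOf e.1))⟩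
      have h2 : IsEmpty {e : N.E // N.pointOf e = P} :=
        ⟨fun e => hP (e.2 ▸ isMin_pointOf e.1)⟩
      exact ⟨Equiv.equivOfIsEmpty _ _⟩
  let f : M.E ≃ N.E := Equiv.ofFiberEquiv fun P => (hfib P).some
  have hf : ∀ e, N.pointOf (f e) = θ (M.pointOf e) := fun e => Equiv.ofFiberEquiv_map _ e
  have key : ∀ (F : M.NonemptyFlat) (e : M.E), e.1 ∈ F.1 ↔ (f e).1 ∈ (θ F).1 := fun F e => by
    rw [← pointOf_le_iff, ← pointOf_le_iff, hf, θ.le_iff_le]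
  refine isIsomorphic_of_flats f (fun F hF => ?_) fun G hG => ?_
  · rcases F.eq_empty_or_nonempty with rfl | hne
    · exact ⟨∅, N.isCyclicFlat_empty.1, by simp⟩
    · exact ⟨_, (θ ⟨F, hF, hne⟩).2.1, key ⟨F, hF, hne⟩⟩
  · rcases G.eq_empty_or_nonempty with rfl | hne
    · exact ⟨∅, M.isCyclicFlat_empty.1, by simp⟩
    · refine ⟨_, (θ.symm ⟨G, hG, hne⟩).2.1, fun e => ?_⟩
      rw [key, θ.apply_symm_apply]

instance finite_nonemptyFlat [M.Finite] : Finite M.NonemptyFlat :=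
  ((M.ground_finite.finite_subsets).subset fun _ h => h.1.subset_ground).to_subtype

/-! ### Configurations of tipless cones -/

/-- A configuration of the tipless `m`-cone of `M`, described in terms of `M`: its elements are
the cones (without the tip) of the nonempty flats of `M`, and the cyclic flats of `M`. The
triple `(L, s, ρ)` does not record which elements are of which kind. -/
structure TiplessConfiguration (M : Matroid α) (m : ℕ) {L : Type*} [PartialOrder L]
    (s ρ : L → ℕ) where
  /-- The cone of a nonempty flat. -/
  cone : M.NonemptyFlat ↪o L
  /-- A cyclic flat of `M`, as a cyclic flat of the tipless cone. -/
  base : {Z : Set α // M.IsCyclicFlat Z} ↪o L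
  cone_or_base : ∀ x, (∃ F, cone F = x) ∨ ∃ Z, base Z = x
  base_le_cone : ∀ Z F, base Z ≤ cone F ↔ Z.1 ⊆ F.1
  not_cone_le_base : ∀ F Z, ¬ cone F ≤ base Z
  size_cone : ∀ F, s (cone F) = (m + 1) * F.1.ncard
  size_base : ∀ Z, s (base Z) = Z.1.ncard
  rank_cone : ∀ F, (ρ (cone F) : ℕ∞) = M.eRk F.1 + 1
  rank_base : ∀ Z, (ρ (base Z) : ℕ∞) = M.eRk Z.1

namespace TiplessConfiguration

variable {L : Type*} [PartialOrder L] {s ρ : L → ℕ} {m n : ℕ}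

theorem exists_cone_of_cone_le (C : TiplessConfiguration M m s ρ) {G : M.NonemptyFlat} {x : L}
    (h : C.cone G ≤ x) : ∃ F, C.cone F = x ∧ G ≤ F := by
  rcases C.cone_or_base x with ⟨F, rfl⟩ | ⟨Z, rfl⟩
  · exact ⟨F, rfl, C.cone.le_iff_le.1 h⟩
  · exact absurd h (C.not_cone_le_base _ _)

theorem exists_cone_of_not_le_base (C : TiplessConfiguration M m s ρ)
    {hE : M.IsCyclicFlat M.E} {x : L} (h : ¬ x ≤ C.base ⟨M.E, hE⟩) : ∃ F, C.cone F = x := by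
  rcases C.cone_or_base x with h' | ⟨Z, rfl⟩
  · exact h'
  · exact absurd (C.base.le_iff_le.2 Z.2.1.subset_ground) h

theorem exists_base_of_le_base (C : TiplessConfiguration M m s ρ)
    {Z : {Z : Set α // M.IsCyclicFlat Z}} {x : L} (h : x ≤ C.base Z) : ∃ Y, C.base Y = x := by
  rcases C.cone_or_base x with ⟨F, rfl⟩ | h'
  · exact absurd h (C.not_cone_le_base _ _)
  · exact h'

theorem le_cone_of_ground_subset (C : TiplessConfiguration M m s ρ) {F : M.NonemptyFlat}
    (hF : M.E ⊆ F.1) (x : L) : x ≤ C.cone F := by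
  rcases C.cone_or_base x with ⟨G, rfl⟩ | ⟨Z, rfl⟩
  · exact C.cone.le_iff_le.2 (G.2.1.subset_ground.trans hF)
  · exact (C.base_le_cone _ _).2 (Z.2.1.subset_ground.trans hF)

theorem cone_ne_base (C : TiplessConfiguration M m s ρ) (F : M.NonemptyFlat)
    (Z : {Z : Set α // M.IsCyclicFlat Z}) : C.cone F ≠ C.base Z :=
  fun h => C.not_cone_le_base _ _ h.le

/-- If a cone over `M` plays the role of a cyclic flat of `N`, then the largest such cone is that
of a hyperplane `H` of `M`, and it plays the role of the ground set of `N`. Indeed, all flats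
properly above `H` give cones over `N`, so that they contain a common flat properly above `H`. -/
theorem exists_hyperplane [M.Finite] (C : TiplessConfiguration M m s ρ)
    (D : TiplessConfiguration N n s ρ) {F : M.NonemptyFlat} {Z : {Z : Set β // N.IsCyclicFlat Z}}
    (hFZ : C.cone F = D.base Z) :
    ∃ (H : M.NonemptyFlat) (hE : N.IsCyclicFlat N.E), C.cone H = D.base ⟨N.E, hE⟩ ∧
      ∀ e ∈ M.E, e ∉ H.1 → M.closure (insert e H.1) = M.E := by
  obtain ⟨H, ⟨Y, hY⟩, hmax⟩ := (toFinite {F | ∃ Z, C.cone F = D.base Z}).exists_maximal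
    ⟨F, Z, hFZ⟩
  have hYne : Y.1.Nonempty := by
    rw [nonempty_iff_ne_empty]
    intro h0
    have h1 := C.size_cone H
    rw [hY, D.size_base, h0, ncard_empty] at h1
    have h2 : 0 < H.1.ncard :=
      (ncard_pos (M.ground_finite.subset H.2.1.subset_ground)).2 H.2.2
    exact absurd h1 (Nat.mul_pos m.succ_pos h2).ne
  have hYc : C.cone H ≤ D.cone ⟨Y.1, Y.2.1, hYne⟩ := by
    rw [hY, D.base_le_cone]
  obtain ⟨G, hG, hHG⟩ := C.exists_cone_of_cone_le hYc
  have hGH : ¬ G ≤ H := fun h => by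
    rw [hHG.antisymm h, hG] at hY
    exact D.cone_ne_base _ _ hY
  -- by maximality of `H`, the flat `G` is the least one properly above `H`
  have hmin : ∀ F, H ≤ F → ¬ F ≤ H → G ≤ F := by
    intro F hHF hFH
    rcases D.cone_or_base (C.cone F) with ⟨G', hG'⟩ | ⟨Z, hZ⟩
    · rw [← C.cone.le_iff_le, hG, ← hG', D.cone.le_iff_le]
      refine (D.base_le_cone _ _).1 ?_
      rw [← hY, hG', C.cone.le_iff_le]
      exact hHF
    · exact absurd (hmax ⟨Z, hZ.symm⟩ hHF) hFH
  have hmin' : ∀ e ∈ M.E, e ∉ H.1 → G.1 ⊆ M.closure (insert e H.1) := by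
    intro e he heH
    have hsub : insert e H.1 ⊆ M.E := insert_subset he H.2.1.subset_ground
    have hcl := M.subset_closure _ hsub
    refine hmin ⟨_, M.isFlat_closure (insert e H.1), ⟨e, hcl (mem_insert _ _)⟩⟩ ?_ ?_
    · exact (subset_insert _ _).trans hcl
    · exact fun h => heH (h (hcl (mem_insert _ _)))
  obtain ⟨g, hg, hgH⟩ := not_subset.1 hGH
  -- a second flat covering `H` would not contain `G`, so `G` is everything
  have hGE : M.E ⊆ G.1 := by
    intro e he
    by_contra heG
    have h1 := hmin' e he (fun h => heG (hHG h)) hg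
    have h2 := M.mem_closure_insert (H.2.1.closure.symm ▸ hgH) h1
    exact heG (G.2.1.closure.subset (M.closure_subset_closure (insert_subset hg hHG) h2))
  have hYE : Y.1 = N.E := by
    refine Y.2.1.subset_ground.antisymm ?_
    have h1 : D.cone ⟨N.E, N.ground_isFlat, hYne.mono Y.2.1.subset_ground⟩ ≤ _ :=
      C.le_cone_of_ground_subset hGE _
    rw [hG, D.cone.le_iff_le] at h1
    exact h1
  obtain ⟨Y, hYflat⟩ := Y
  obtain rfl : Y = N.E := hYE
  exact ⟨H, hYflat, hY, fun e he heH =>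
    (M.closure_subset_ground _).antisymm (hGE.trans (hmin' e he heH))⟩

theorem isCyclicFlat_of_eRk_eq_one [M.Finite] [M.Loopless] {P : Set α} (hP : M.IsFlat P)
    (hr : M.eRk P = 1) (hc : 1 < P.ncard) : M.IsCyclicFlat P := by
  refine ⟨hP, isCyclic_of_forall_mem_closure hP.subset_ground fun e he => ?_⟩
  have hPf : P.Finite := M.ground_finite.subset hP.subset_ground
  obtain ⟨f, hf, hfe⟩ := exists_ne_of_one_lt_ncard hc e
  have h1 : M.closure {f} = M.closure P := by
    refine IsRkFinite.closure_eq_closure_of_subset_of_eRk_ge_eRk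
      (M.isRkFinite_of_finite (finite_singleton f)) (singleton_subset_iff.2 hf) ?_
    rw [hr, eRk_singleton_eq (hP.subset_ground hf)]
  refine M.closure_subset_closure (Y := P \ {e}) (singleton_subset_iff.2 ⟨hf, hfe⟩) ?_
  rw [h1, hP.closure]
  exact he

section Swap

variable [M.Finite] {C : TiplessConfiguration M m s ρ}
  {D : TiplessConfiguration N n s ρ} {H : M.NonemptyFlat} {hE : N.IsCyclicFlat N.E}

theorem ncard_ground_of_swap [N.Finite] (hH : C.cone H = D.base ⟨N.E, hE⟩) :
    N.E.ncard = (m + 1) * H.1.ncard ∧ M.E.ncard = (n + 1) * H.1.ncard := by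
  have h1 : N.E.ncard = (m + 1) * H.1.ncard := by
    rw [← C.size_cone, hH, D.size_base]
  have hpos : 0 < H.1.ncard :=
    (ncard_pos (M.ground_finite.subset H.2.1.subset_ground)).2 H.2.2
  have hNE : N.E.Nonempty := by
    rw [← ncard_pos N.ground_finite, h1]; positivity
  have h2 : C.cone ⟨M.E, M.ground_isFlat, H.2.2.mono H.2.1.subset_ground⟩ =
      D.cone ⟨N.E, N.ground_isFlat, hNE⟩ :=
    (D.le_cone_of_ground_subset Subset.rfl _).antisymm (C.le_cone_of_ground_subset Subset.rfl _)
  refine ⟨h1, Nat.eq_of_mul_eq_mul_left m.succ_pos ?_⟩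
  have h3 := C.size_cone ⟨M.E, M.ground_isFlat, H.2.2.mono H.2.1.subset_ground⟩
  rw [h2, D.size_cone, h1] at h3
  rw [Nat.succ_eq_add_one, ← h3]
  ring

/-- A point outside `H` is a single element: otherwise it would be a cyclic flat of rank one
that corresponds to a cone over `N`, and cones have rank at least two. -/
theorem ncard_eq_one_of_swap [M.Loopless] [N.Loopless]
    (hH : C.cone H = D.base ⟨N.E, hE⟩) {P : Set α} (hP : M.IsFlat P)
    (hr : M.eRk P = 1) (hPH : ¬ P ⊆ H.1) : P.ncard = 1 := by
  have hPne : P.Nonempty := by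
    rw [nonempty_iff_ne_empty]; rintro rfl; simp at hr
  have hpos : 0 < P.ncard := (ncard_pos (M.ground_finite.subset hP.subset_ground)).2 hPne
  by_contra hne
  have hcf := isCyclicFlat_of_eRk_eq_one hP hr (by omega)
  obtain ⟨F, hF⟩ := D.exists_cone_of_not_le_base (hE := hE) (x := C.base ⟨P, hcf⟩) (by
    rw [← hH, C.base_le_cone]; exact hPH)
  have h1 := C.rank_base ⟨P, hcf⟩
  rw [← hF, D.rank_cone, hr] at h1
  obtain ⟨f, hf⟩ := F.2.2
  have h2 : 1 ≤ N.eRk F.1 := by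
    rw [← eRk_singleton_eq (M := N) (F.2.1.subset_ground hf)]
    exact N.eRk_mono (singleton_subset_iff.2 hf)
  have h3 := add_le_add_left h2 1
  rw [h1] at h3
  exact absurd h3 (by decide)

theorem closure_singleton_eq_of_swap [M.Loopless] [N.Loopless]
    (hH : C.cone H = D.base ⟨N.E, hE⟩) {e : α} (he : e ∈ M.E) (heH : e ∉ H.1) :
    M.closure {e} = {e} := by
  obtain ⟨x, hx⟩ := ncard_eq_one.1 <| ncard_eq_one_of_swap hH (M.isFlat_closure {e})
    ((M.eRk_closure_eq _).trans (eRk_singleton_eq he))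
    fun h => heH (h (mem_closure_singleton_self he))
  have := mem_closure_singleton_self he
  rw [hx] at this ⊢
  rw [mem_singleton_iff.1 this]

/-- Any two elements outside `H` are collinear with each element of `H`. -/
theorem mem_closure_pair_of_swap (hH : C.cone H = D.base ⟨N.E, hE⟩) {p e f : α} (hp : p ∈ H.1)
    (he : e ∈ M.E) (heH : e ∉ H.1) (hf : f ∈ M.E) (hfH : f ∉ H.1) : e ∈ M.closure {f, p} := by
  have hpE := H.2.1.subset_ground hp
  set P : M.NonemptyFlat := M.pointOf ⟨p, hpE⟩
  have hPH : P ≤ H := pointOf_le_iff.2 hp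
  obtain ⟨Z, hZ⟩ := D.exists_base_of_le_base (hH ▸ C.cone.le_iff_le.2 hPH)
  have hsize := C.size_cone P
  have hZne : Z.1.Nonempty := by
    rw [nonempty_iff_ne_empty]
    intro h0
    rw [← hZ, D.size_base, h0, ncard_empty] at hsize
    have h2 : 0 < P.1.ncard := (ncard_pos (M.ground_finite.subset P.2.1.subset_ground)).2 P.2.2
    exact absurd hsize (Nat.mul_pos m.succ_pos h2).ne
  -- the flat `G` whose cone over `M` is the cone over `N` of `Z` lies on both lines through `p`
  obtain ⟨G, hG, hPG⟩ := C.exists_cone_of_cone_le (G := P) (x := D.cone ⟨Z.1, Z.2.1, hZne⟩)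
    (by rw [← hZ, D.base_le_cone])
  have hGP : ¬ G ≤ P := fun h => by
    rw [← hPG.antisymm h, ← hZ] at hG
    exact D.cone_ne_base _ _ hG.symm
  have hline : ∀ x ∈ M.E, x ∉ H.1 → G.1 ⊆ M.closure {x, p} := by
    intro x hx hxH
    have hsub : ({x, p} : Set α) ⊆ M.E := insert_subset hx (singleton_subset_iff.2 hpE)
    have hcl := M.subset_closure _ hsub
    set F : M.NonemptyFlat := ⟨_, M.isFlat_closure {x, p}, ⟨x, hcl (mem_insert _ _)⟩⟩
    have hPF : P ≤ F := pointOf_le_iff.2 (hcl (by simp))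
    obtain ⟨F', hF'⟩ := D.exists_cone_of_not_le_base (hE := hE) (x := C.cone F) (by
      rw [← hH, C.cone.le_iff_le]; exact fun h => hxH (h (hcl (mem_insert _ _))))
    have : G ≤ F := by
      rw [← C.cone.le_iff_le, hG, ← hF', D.cone.le_iff_le]
      refine (D.base_le_cone _ _).1 ?_
      rw [hZ, hF', C.cone.le_iff_le]
      exact hPF
    exact this
  obtain ⟨g, hg, hgP⟩ := not_subset.1 hGP
  have h1 := M.mem_closure_insert hgP (hline e he heH hg)
  have hpf : p ∈ M.closure {f, p} := M.mem_closure_of_mem (by simp)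
    (insert_subset hf (singleton_subset_iff.2 hpE))
  refine (M.isFlat_closure {f, p}).closure.subset (M.closure_subset_closure ?_ h1)
  exact insert_subset (hline f hf hfH hg) (singleton_subset_iff.2 hpf)

/-- Any two elements outside `H` span `M`, which is thus a line. -/
theorem closure_pair_eq_ground_of_swap [M.Loopless] [N.Loopless] (hH : C.cone H = D.base ⟨N.E, hE⟩)
    (hhyp : ∀ e ∈ M.E, e ∉ H.1 → M.closure (insert e H.1) = M.E) {e f : α}
    (he : e ∈ M.E) (heH : e ∉ H.1) (hf : f ∈ M.E) (hfH : f ∉ H.1) (hef : e ≠ f) :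
    M.closure {e, f} = M.E := by
  refine (M.closure_subset_ground _).antisymm ?_
  rw [← hhyp e he heH, M.closure_subset_closure_iff_subset_closure
    (insert_subset he H.2.1.subset_ground)]
  refine insert_subset (M.mem_closure_of_mem (by simp)
    (insert_subset he (singleton_subset_iff.2 hf))) fun p hp => ?_
  have h1 := mem_closure_pair_of_swap hH hp he heH hf hfH
  rw [pair_comm] at h1
  refine M.mem_closure_insert ?_ h1
  rw [closure_singleton_eq_of_swap hH hf hfH]
  exact hef

theorem exists_pair_of_swap [N.Finite] (hn : 1 < n) (hH : C.cone H = D.base ⟨N.E, hE⟩) :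
    (M.E \ H.1).ncard = n * H.1.ncard ∧ (M.E \ H.1).Nontrivial := by
  have h1 := (ncard_ground_of_swap hH).2
  have h2 := ncard_sdiff_add_ncard_of_subset H.2.1.subset_ground M.ground_finite
  have hpos : 0 < H.1.ncard :=
    (ncard_pos (M.ground_finite.subset H.2.1.subset_ground)).2 H.2.2
  have h3 : (M.E \ H.1).ncard = n * H.1.ncard := by
    rw [h1] at h2; linarith
  refine ⟨h3, ?_⟩
  rw [← one_lt_ncard_iff_nontrivial_and_finite.trans (and_iff_left (M.ground_finite.sdiff)), h3]
  nlinarith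

theorem eRk_eq_one_of_swap [M.Loopless] [N.Finite] [N.Loopless] (hn : 1 < n)
    (hH : C.cone H = D.base ⟨N.E, hE⟩)
    (hhyp : ∀ e ∈ M.E, e ∉ H.1 → M.closure (insert e H.1) = M.E) : M.eRk H.1 = 1 := by
  obtain ⟨e, he, f, hf, hef⟩ := (exists_pair_of_swap hn hH).2
  have h1 := eRk_insert_eq_add_one (M := M) (X := H.1) (e := e) ⟨he.1, by
    rw [H.2.1.closure]; exact he.2⟩
  have h2 : M.eRk (insert e H.1) ≤ 2 := by
    rw [← M.eRk_closure_eq, hhyp e he.1 he.2,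
      ← closure_pair_eq_ground_of_swap hH hhyp he.1 he.2 hf.1 hf.2 hef, M.eRk_closure_eq,
      ← encard_pair hef]
    exact M.eRk_le_encard _
  obtain ⟨p, hp⟩ := H.2.2
  have h3 : 1 ≤ M.eRk H.1 := by
    rw [← eRk_singleton_eq (M := M) (H.2.1.subset_ground hp)]
    exact M.eRk_mono (singleton_subset_iff.2 hp)
  rw [h1] at h2
  refine le_antisymm ((ENat.add_le_add_iff_right (k := 1) (by simp)).1 (h2.trans ?_)) h3
  decide

/-- The flats of `M` when a cone over `M` plays the role of the ground set of `N`: the empty set,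
the point `H`, the single elements outside `H`, and the ground set. -/
theorem isFlat_iff_of_swap [M.Loopless] [N.Finite] [N.Loopless] (hn : 1 < n)
    (hH : C.cone H = D.base ⟨N.E, hE⟩)
    (hhyp : ∀ e ∈ M.E, e ∉ H.1 → M.closure (insert e H.1) = M.E) {F : Set α} :
    M.IsFlat F ↔ F = ∅ ∨ F = M.E ∨ F = H.1 ∨ ∃ e ∈ M.E \ H.1, F = {e} := by
  constructor
  · intro hF
    rcases F.eq_empty_or_nonempty with h0 | ⟨p, hp⟩
    · exact Or.inl h0
    right
    have hfull : ∀ e ∈ F, e ∉ H.1 → H.1 ⊆ F → F = M.E := by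
      intro e he heH hHF
      refine hF.subset_ground.antisymm ?_
      rw [← hhyp e (hF.subset_ground he) heH]
      exact (M.closure_subset_closure (insert_subset he hHF)).trans hF.closure.subset
    have hsub : ∀ e ∈ F, e ∈ H.1 → H.1 ⊆ F := by
      intro e heF heH
      have : M.closure {e} = M.closure H.1 := by
        refine IsRkFinite.closure_eq_closure_of_subset_of_eRk_ge_eRk
          (M.isRkFinite_of_finite (finite_singleton e)) (singleton_subset_iff.2 heH) ?_
        rw [eRk_eq_one_of_swap hn hH hhyp, eRk_singleton_eq (hF.subset_ground heF)]
      rw [← H.2.1.closure, ← this]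
      exact (M.closure_subset_closure (singleton_subset_iff.2 heF)).trans hF.closure.subset
    by_cases hFH : F ⊆ H.1
    · exact Or.inr (Or.inl (hFH.antisymm (hsub p hp (hFH hp))))
    obtain ⟨e, he, heH⟩ := not_subset.1 hFH
    by_cases hFe : F ⊆ {e}
    · exact Or.inr (Or.inr ⟨e, ⟨hF.subset_ground he, heH⟩,
        hFe.antisymm (singleton_subset_iff.2 he)⟩)
    obtain ⟨f, hf, hfe⟩ := not_subset.1 hFe
    refine Or.inl ?_
    by_cases hfH : f ∈ H.1
    · exact hfull e he heH (hsub f hf hfH)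
    refine hF.subset_ground.antisymm ?_
    rw [← closure_pair_eq_ground_of_swap hH hhyp (hF.subset_ground he) heH (hF.subset_ground hf)
      hfH (Ne.symm hfe)]
    exact (M.closure_subset_closure (insert_subset he (singleton_subset_iff.2 hf))).trans
      hF.closure.subset
  · rintro (rfl | rfl | rfl | ⟨e, he, rfl⟩)
    · exact M.isCyclicFlat_empty.1
    · exact M.ground_isFlat
    · exact H.2.1
    · rw [isFlat_iff_closure_eq]
      exact closure_singleton_eq_of_swap hH he.1 he.2

theorem isCyclicFlat_ground_of_swap [M.Loopless] [N.Finite] [N.Loopless] (hn : 1 < n)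
    (hH : C.cone H = D.base ⟨N.E, hE⟩)
    (hhyp : ∀ e ∈ M.E, e ∉ H.1 → M.closure (insert e H.1) = M.E) : M.IsCyclicFlat M.E := by
  refine ⟨M.ground_isFlat, isCyclic_of_forall_mem_closure Subset.rfl fun x hx => ?_⟩
  have hnt := (exists_pair_of_swap hn hH).2
  by_cases hxH : x ∈ H.1
  · obtain ⟨e, he, f, hf, hef⟩ := hnt
    refine M.closure_subset_closure (X := {e, f}) (Y := M.E \ {x}) (insert_subset ⟨he.1, ?_⟩
      (singleton_subset_iff.2 ⟨hf.1, ?_⟩)) ?_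
    · rintro rfl; exact he.2 hxH
    · rintro rfl; exact hf.2 hxH
    · rw [closure_pair_eq_ground_of_swap hH hhyp he.1 he.2 hf.1 hf.2 hef]; exact hx
  · obtain ⟨y, hy, hyx⟩ := hnt.exists_ne x
    obtain ⟨p, hp⟩ := H.2.2
    refine M.closure_subset_closure (X := {y, p})
      (Y := M.E \ {x}) (insert_subset ⟨hy.1, hyx⟩
      (singleton_subset_iff.2 ⟨H.2.1.subset_ground hp, ?_⟩)) ?_
    · rintro rfl; exact hxH hp
    · exact mem_closure_pair_of_swap hH hp hx hxH hy.1 hy.2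

end Swap

end TiplessConfiguration

/-! ### Reconstruction from the tipless cone -/

theorem isIsomorphic_of_orderEmbedding [M.Finite] [N.Finite] [M.Loopless] [N.Loopless]
    {L : Type*} [PartialOrder L] (c : M.NonemptyFlat ↪o L) (d : N.NonemptyFlat ↪o L)
    (hcd : range c = range d)
    (hP : ∀ P Q, IsMin P → IsMin Q → c P = d Q → P.1.ncard = Q.1.ncard) :
    M.IsIsomorphic N := by
  let θ : M.NonemptyFlat ≃o N.NonemptyFlat :=
    c.orderIso.trans ((OrderIso.setCongr _ _ hcd).trans d.orderIso.symm)
  have hθ : ∀ P, c P = d (θ P) := fun P => by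
    have : d.orderIso (θ P) = OrderIso.setCongr _ _ hcd (c.orderIso P) := by simp [θ]
    exact (congrArg Subtype.val this).symm
  exact isIsomorphic_of_orderIso θ fun P h => hP P _ h (θ.isMin_apply.2 h) (hθ P)

theorem exists_equiv_of_ncard_eq {A E : Set α} {B K : Set β} (hE : E.Finite) (hK : K.Finite)
    (hAE : A ⊆ E) (hBK : B ⊆ K) (hAB : A.ncard = B.ncard) (hEK : (E \ A).ncard = (K \ B).ncard) :
    ∃ f : E ≃ K, ∀ e : E, e.1 ∈ A ↔ (f e).1 ∈ B := by
  classical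
  have := (hE.subset hAE).to_subtype
  have := (hK.subset hBK).to_subtype
  have := (hE.sdiff (t := A)).to_subtype
  have := (hK.sdiff (t := B)).to_subtype
  let f₁ : A ≃ B := (Finite.equivFinOfCardEq hAB).trans (Finite.equivFin _).symm
  let f₂ : ↥(E \ A) ≃ ↥(K \ B) := (Finite.equivFinOfCardEq hEK).trans (Finite.equivFin _).symm
  refine ⟨(Equiv.Set.sumDiffSubset hAE).symm.trans
    ((Equiv.sumCongr f₁ f₂).trans (Equiv.Set.sumDiffSubset hBK)), fun e => ?_⟩
  obtain ⟨x, rfl⟩ := (Equiv.Set.sumDiffSubset hAE).surjective e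
  simp only [Equiv.trans_apply, Equiv.symm_apply_apply, Equiv.sumCongr_apply]
  rcases x with x | x
  · rw [Sum.map_inl, Equiv.Set.sumDiffSubset_apply_inl, Equiv.Set.sumDiffSubset_apply_inl]
    exact iff_of_true x.2 (f₁ x).2
  · rw [Sum.map_inr, Equiv.Set.sumDiffSubset_apply_inr, Equiv.Set.sumDiffSubset_apply_inr]
    exact iff_of_false x.2.2 (f₂ x).2.2

namespace TiplessConfiguration

variable {L : Type*} [PartialOrder L] {s ρ : L → ℕ} {m n : ℕ}

/-- Even if the configuration does not tell the cones from the other cyclic flats, it determines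
the matroid: such an ambiguity arises only for lines with at most one point of several elements,
the number of which is then the same for both matroids. -/
theorem isIsomorphic_of_swap [M.Finite] [M.Loopless] [N.Finite] [N.Loopless]
    (C : TiplessConfiguration M m s ρ) (D : TiplessConfiguration N n s ρ) (hm : 1 < m)
    (hn : 1 < n) {F : M.NonemptyFlat} {Z : {Z : Set β // N.IsCyclicFlat Z}}
    (hFZ : C.cone F = D.base Z) : M.IsIsomorphic N := by
  obtain ⟨H, hNE, hH, hhyp⟩ := C.exists_hyperplane D hFZ
  have hME := isCyclicFlat_ground_of_swap hn hH hhyp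
  obtain ⟨e₀, he₀⟩ := (exists_pair_of_swap hn hH).2.nonempty
  -- the ground set of `M` is the cone of a flat of `N`, which makes the situation symmetric
  obtain ⟨G, hG⟩ := D.exists_cone_of_not_le_base (hE := hNE) (x := C.base ⟨M.E, hME⟩) (by
    rw [← hH, C.base_le_cone]
    exact fun h => he₀.2 (h he₀.1))
  obtain ⟨K, hME', hK, hhyp'⟩ := D.exists_hyperplane C hG
  have hcard : H.1.ncard = K.1.ncard := by
    have h1 := (ncard_ground_of_swap hH).1
    rw [(ncard_ground_of_swap hK).2] at h1
    exact (Nat.eq_of_mul_eq_mul_left m.succ_pos h1).symm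
  -- an element outside `H` corresponds to one outside `K`, and their cones have the same size
  have hmn : m = n := by
    obtain ⟨F', hF'⟩ := D.exists_cone_of_not_le_base (hE := hNE)
      (x := C.cone (M.pointOf ⟨e₀, he₀.1⟩)) (by
        rw [← hH, C.cone.le_iff_le, pointOf_le_iff]; exact he₀.2)
    have hpt : (M.pointOf ⟨e₀, he₀.1⟩).1 = {e₀} := closure_singleton_eq_of_swap hH he₀.1 he₀.2
    rcases (isFlat_iff_of_swap hm hK hhyp').1 F'.2.1 with h | h | h | ⟨e', -, h⟩
    · exact absurd h F'.2.2.ne_empty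
    · have h1 := D.le_cone_of_ground_subset h.symm.subset (C.cone H)
      rw [hF', C.cone.le_iff_le] at h1
      have h2 : H.1 ⊆ {e₀} := by rw [← hpt]; exact h1
      obtain ⟨p, hp⟩ := H.2.2
      exact absurd (mem_singleton_iff.1 (h2 hp) ▸ hp) he₀.2
    · rw [Subtype.ext h, hK] at hF'
      exact absurd hF'.symm (C.cone_ne_base _ _)
    · have h1 := C.size_cone (M.pointOf ⟨e₀, he₀.1⟩)
      rw [← hF', D.size_cone, h, hpt, ncard_singleton, ncard_singleton] at h1
      omega
  subst hmn
  obtain ⟨f, hf⟩ := exists_equiv_of_ncard_eq M.ground_finite N.ground_finite H.2.1.subset_ground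
    K.2.1.subset_ground hcard (by
      rw [(exists_pair_of_swap hn hH).1, (exists_pair_of_swap hm hK).1, hcard])
  refine isIsomorphic_of_flats f (fun F hF => ?_) fun G hG => ?_
  · rcases (isFlat_iff_of_swap hn hH hhyp).1 hF with rfl | rfl | rfl | ⟨e, he, rfl⟩
    · exact ⟨∅, N.isCyclicFlat_empty.1, by simp⟩
    · exact ⟨N.E, N.ground_isFlat, fun e => by simp⟩
    · exact ⟨K.1, K.2.1, hf⟩
    · refine ⟨{(f ⟨e, he.1⟩).1}, (isFlat_iff_of_swap hm hK hhyp').2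
        (Or.inr (Or.inr (Or.inr ⟨_, ⟨(f ⟨e, he.1⟩).2, fun h => he.2 ((hf _).2 h)⟩, rfl⟩))), ?_⟩
      intro x
      rw [mem_singleton_iff, mem_singleton_iff, ← Subtype.ext_iff, f.apply_eq_iff_eq,
        Subtype.ext_iff]
  · rcases (isFlat_iff_of_swap hm hK hhyp').1 hG with rfl | rfl | rfl | ⟨e, he, rfl⟩
    · exact ⟨∅, M.isCyclicFlat_empty.1, by simp⟩
    · exact ⟨M.E, M.ground_isFlat, fun e => by simp⟩
    · exact ⟨H.1, H.2.1, hf⟩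
    · refine ⟨{(f.symm ⟨e, he.1⟩).1}, (isFlat_iff_of_swap hn hH hhyp).2
        (Or.inr (Or.inr (Or.inr ⟨_, ⟨(f.symm ⟨e, he.1⟩).2, fun h => he.2 ?_⟩, rfl⟩))), ?_⟩
      · simpa using (hf _).1 h
      · intro x
        rw [mem_singleton_iff, mem_singleton_iff, ← Subtype.ext_iff, Equiv.eq_symm_apply,
          Subtype.ext_iff]

/-- A point with several elements can be read off as the cyclic flat of `M` below its cone. -/
theorem ncard_eq_of_cone_eq [M.Finite] [M.Loopless] (C : TiplessConfiguration M m s ρ)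
    (D : TiplessConfiguration N n s ρ) (hD : ∀ G, ∃ F, C.cone F = D.cone G) {P : M.NonemptyFlat}
    {Q : N.NonemptyFlat}
    (hP : IsMin P) (hQ : IsMin Q) (hPQ : C.cone P = D.cone Q) (hc : 1 < P.1.ncard) :
    P.1.ncard = Q.1.ncard := by
  have hcf := isCyclicFlat_of_eRk_eq_one P.2.1 (eRk_eq_one_of_isMin hP) hc
  rcases D.cone_or_base (C.base ⟨P.1, hcf⟩) with ⟨G, hG⟩ | ⟨Z, hZ⟩
  · obtain ⟨F, hF⟩ := hD G
    exact absurd (hF.trans hG) (C.cone_ne_base _ _)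
  · have hsize := C.size_base ⟨P.1, hcf⟩
    rw [← hZ, D.size_base] at hsize
    have hne : Z.1.Nonempty := by
      rw [nonempty_iff_ne_empty]
      intro h0
      rw [h0, ncard_empty] at hsize
      change 0 = P.1.ncard at hsize
      omega
    have hle : Z.1 ⊆ Q.1 := by
      rw [← D.base_le_cone, hZ, ← hPQ, C.base_le_cone]
    have hle' : (⟨Z.1, Z.2.1, hne⟩ : N.NonemptyFlat) ≤ Q := hle
    rw [← hQ.eq_of_le hle']
    exact hsize.symm

theorem isIsomorphic [M.Finite] [M.Loopless] [N.Finite] [N.Loopless]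
    (C : TiplessConfiguration M m s ρ) (D : TiplessConfiguration N n s ρ) (hm : 1 < m)
    (hn : 1 < n) : M.IsIsomorphic N := by
  -- the cones over `M` and those over `N` are the same elements of `L`, or one of them is swapped
  by_cases hC : ∃ F Z, C.cone F = D.base Z
  · obtain ⟨F, Z, hFZ⟩ := hC
    exact C.isIsomorphic_of_swap D hm hn hFZ
  by_cases hD : ∃ G Z, D.cone G = C.base Z
  · obtain ⟨G, Z, hGZ⟩ := hD
    exact (D.isIsomorphic_of_swap C hn hm hGZ).symm
  push Not at hC hD
  have hC' : ∀ F, ∃ G, D.cone G = C.cone F := fun F =>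
    (D.cone_or_base (C.cone F)).resolve_right fun ⟨Z, hZ⟩ => hC F Z hZ.symm
  have hD' : ∀ G, ∃ F, C.cone F = D.cone G := fun G =>
    (C.cone_or_base (D.cone G)).resolve_right fun ⟨Z, hZ⟩ => hD G Z hZ.symm
  refine isIsomorphic_of_orderEmbedding C.cone D.cone ?_ fun P Q hP hQ hPQ => ?_
  · ext x
    constructor
    · rintro ⟨F, rfl⟩; exact hC' F
    · rintro ⟨G, rfl⟩; exact hD' G
  · have h1 := C.ncard_eq_of_cone_eq D hD' hP hQ hPQ
    have h2 := D.ncard_eq_of_cone_eq C hC' hQ hP hPQ.symm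
    have h3 := (ncard_pos (M.ground_finite.subset P.2.1.subset_ground)).2 P.2.2
    have h4 := (ncard_pos (N.ground_finite.subset Q.2.1.subset_ground)).2 Q.2.2
    by_cases hp : 1 < P.1.ncard
    · exact h1 hp
    by_cases hq : 1 < Q.1.ncard
    · exact (h2 hq).symm
    omega

end TiplessConfiguration

section Configuration

variable {m : ℕ} [M.Finite] [M.Loopless] {L : Type*} [PartialOrder L] {s ρ : L → ℕ}

theorem isCyclicFlat_base_image_delete_tip (hm : 1 ≤ m) {Z : Set α} (hZ : M.IsCyclicFlat Z) :
    (explicitCone M m ＼ {ConeElt.tip}).IsCyclicFlat (ConeElt.base '' Z) := by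
  have hd : Disjoint (ConeElt.base '' Z : Set (ConeElt α m)) {ConeElt.tip} := by simp
  have h := ((explicitCone_isFreeCone M hm).isCyclicFlat_iff (ConeElt.base '' Z)).2
    (Or.inl ⟨Z, hZ, rfl⟩)
  refine ⟨?_, isCyclic_delete_iff.2 ⟨h.2, hd⟩⟩
  have := h.1.delete {ConeElt.tip}
  rwa [hd.sdiff_eq_left] at this

theorem three_le_encard_cone_sdiff_tip (hm : 1 < m) (e : α) :
    3 ≤ (coneSet m {e} \ {ConeElt.tip}).encard := by
  rw [encard_coneSet_sdiff_tip, encard_singleton, mul_one]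
  exact_mod_cast Nat.succ_le_succ hm

theorem nonempty_tiplessConfiguration (hm : 1 < m)
    (h : (explicitCone M m ＼ {ConeElt.tip}).IsConfiguration s ρ) :
    Nonempty (TiplessConfiguration M m s ρ) := by
  obtain ⟨φ, hφ⟩ := h
  have h3 := three_le_encard_cone_sdiff_tip (α := α) hm
  have hne := sdiff_tip_sdiff_nonempty (α := α) hm.le (E := ∅) (D := {ConeElt.tip}) (by simp)
  have hcone : ∀ F : M.NonemptyFlat, (explicitCone M m ＼ {ConeElt.tip}).IsCyclicFlat
      (coneSet m F.1 \ {ConeElt.tip}) := fun F =>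
    isCyclicFlat_coneSet_sdiff (fun e _ => h3 e) F.2.1 F.2.2
  have hbase : ∀ Z : {Z // M.IsCyclicFlat Z}, (explicitCone M m ＼ {ConeElt.tip}).IsCyclicFlat
      (ConeElt.base '' Z.1) := fun Z => isCyclicFlat_base_image_delete_tip hm.le Z.2
  refine ⟨{
    cone := OrderEmbedding.ofMapLEIff (fun F => φ.symm ⟨_, hcone F⟩) fun F G => ?_
    base := OrderEmbedding.ofMapLEIff (fun Z => φ.symm ⟨_, hbase Z⟩) fun Y Z => ?_
    cone_or_base := fun x => ?_
    base_le_cone := fun Z F => ?_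
    not_cone_le_base := fun F Z => ?_
    size_cone := fun F => ?_
    size_base := fun Z => ?_
    rank_cone := fun F => ?_
    rank_base := fun Z => ?_ }⟩
  · rw [φ.symm.le_iff_le]
    exact coneSet_sdiff_subset_iff fun e _ => hne e
  · rw [φ.symm.le_iff_le]
    exact image_subset_image_iff base_injective
  · rcases isCyclicFlat_delete_cases hm.le (φ x).2 with ⟨Z, hZ, h⟩ | ⟨F, hF, hFne, h⟩
    · right
      refine ⟨⟨Z, hZ⟩, φ.symm_apply_eq.2 (Subtype.ext ?_)⟩
      rw [h]
      exact (Disjoint.sdiff_eq_left (by simp)).symm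
    · exact Or.inl ⟨⟨F, hF, hFne⟩, φ.symm_apply_eq.2 (Subtype.ext h.symm)⟩
  · simp only [OrderEmbedding.coe_ofMapLEIff]
    rw [φ.symm.le_iff_le]
    change ConeElt.base '' Z.1 ⊆ coneSet m F.1 \ {ConeElt.tip} ↔ _
    refine ⟨fun h e he => base_mem_coneSet.1 (h ⟨e, he, rfl⟩).1, fun h => ?_⟩
    exact subset_sdiff.2 ⟨base_image_subset h, by simp⟩
  · simp only [OrderEmbedding.coe_ofMapLEIff]
    rw [φ.symm.le_iff_le]
    intro h
    obtain ⟨e, he⟩ := F.2.2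
    obtain ⟨f, -, hf⟩ := h (show ConeElt.copy e ⟨0, hm.le⟩ ∈ coneSet m F.1 \ {ConeElt.tip} from
      ⟨copy_mem_coneSet.2 he, by simp⟩)
    cases hf
  · have h1 := (hφ (φ.symm ⟨_, hcone F⟩)).1
    rw [φ.apply_symm_apply, encard_coneSet_sdiff_tip,
      ← (M.ground_finite.subset F.2.1.subset_ground).cast_ncard_eq] at h1
    exact_mod_cast h1.symm
  · have h1 := (hφ (φ.symm ⟨_, hbase Z⟩)).1
    rw [φ.apply_symm_apply, base_injective.encard_image,
      ← (M.ground_finite.subset Z.2.1.subset_ground).cast_ncard_eq] at h1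
    exact_mod_cast h1.symm
  · have h1 := (hφ (φ.symm ⟨_, hcone F⟩)).2
    rw [φ.apply_symm_apply, eRk_coneSet_sdiff (fun e _ => h3 e) F.2.1 F.2.2] at h1
    exact h1.symm
  · have h1 := (hφ (φ.symm ⟨_, hbase Z⟩)).2
    rw [φ.apply_symm_apply] at h1
    refine h1.symm.trans ?_
    change (explicitCone M m ＼ {ConeElt.tip}).eRk (ConeElt.base '' Z.1) = _
    rw [← restrict_compl, explicitCone_ground, restrict_eRk_eq _
      (subset_sdiff.2 ⟨base_image_subset Z.2.1.subset_ground, by simp⟩),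
      explicitCone_eRk_base Z.2.1.subset_ground]

/-! ### Reconstruction from the baseless cones -/

/-- If the ground set of `M` is deleted from the cone, only the empty set and the cones of the
nonempty flats remain as cyclic flats, so that the latter are those of positive size. -/
theorem exists_orderEmbedding_of_isConfiguration (hm : 1 ≤ m) {D : Set (ConeElt α m)}
    (hD : ConeElt.base '' M.E ⊆ D) (hD' : D ⊆ ConeElt.base '' M.E ∪ {ConeElt.tip})
    (h3 : ∀ e ∈ M.E, 3 ≤ (coneSet m {e} \ D).encard)
    (h : (explicitCone M m ＼ D).IsConfiguration s ρ) :
    ∃ c : M.NonemptyFlat ↪o L, range c = {x | s x ≠ 0} ∧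
      ∀ F, (s (c F) : ℕ∞) = (coneSet m F.1 \ D).encard := by
  obtain ⟨φ, hφ⟩ := h
  have hne := sdiff_tip_sdiff_nonempty hm hD'
  have hcone : ∀ F : M.NonemptyFlat, (explicitCone M m ＼ D).IsCyclicFlat (coneSet m F.1 \ D) :=
    fun F => isCyclicFlat_coneSet_sdiff (fun e he => h3 e (F.2.1.subset_ground he)) F.2.1 F.2.2
  refine ⟨OrderEmbedding.ofMapLEIff (fun F => φ.symm ⟨_, hcone F⟩) fun F G => ?_, ?_, fun F => ?_⟩
  · rw [φ.symm.le_iff_le]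
    exact coneSet_sdiff_subset_iff fun e _ => hne e
  · ext x
    rw [mem_ofPred_eq, ← Nat.cast_ne_zero (R := ℕ∞), ← (hφ x).1, encard_ne_zero]
    constructor
    · rintro ⟨F, rfl⟩
      obtain ⟨e, he⟩ := F.2.2
      obtain ⟨y, hy, hyD⟩ := hne e
      simp only [OrderEmbedding.coe_ofMapLEIff, φ.apply_symm_apply]
      exact ⟨y, coneSet_mono (singleton_subset_iff.2 he) hy.1, hyD⟩
    · intro hx
      rcases isCyclicFlat_delete_cases hm (φ x).2 with ⟨Z, hZ, h⟩ | ⟨F, hF, hFne, h⟩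
      · rw [h, sdiff_eq_empty.2 ((image_mono hZ.1.subset_ground).trans hD)] at hx
        exact absurd hx not_nonempty_empty
      · exact ⟨⟨F, hF, hFne⟩, φ.symm_apply_eq.2 (Subtype.ext h.symm)⟩
  · have h1 := (hφ (φ.symm ⟨_, hcone F⟩)).1
    rw [φ.apply_symm_apply] at h1
    exact h1.symm

theorem exists_orderEmbedding_of_baselessCone (hm : 1 < m)
    (h : (M.baselessCone m hm.le).IsConfiguration s ρ) :
    ∃ c : M.NonemptyFlat ↪o L, range c = {x | s x ≠ 0} ∧
      ∀ F, s (c F) = m * F.1.ncard + 1 := by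
  rw [baselessCone, freeCone_eq_explicitCone] at h
  have h3 : ∀ e ∈ M.E, 3 ≤ (coneSet m {e} \ ConeElt.base '' M.E).encard := fun e he => by
    rw [encard_coneSet_sdiff_base (singleton_subset_iff.2 he), encard_singleton, mul_one]
    exact_mod_cast Nat.succ_le_succ hm
  obtain ⟨c, hc, hs⟩ := exists_orderEmbedding_of_isConfiguration hm.le Subset.rfl
    subset_union_left h3 h
  refine ⟨c, hc, fun F => ?_⟩
  have h1 := hs F
  rw [encard_coneSet_sdiff_base F.2.1.subset_ground,
    ← (M.ground_finite.subset F.2.1.subset_ground).cast_ncard_eq] at h1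
  exact_mod_cast h1

theorem exists_orderEmbedding_of_tiplessBaselessCone (hm : 2 < m)
    (h : (M.tiplessBaselessCone m (one_le_two.trans hm.le)).IsConfiguration s ρ) :
    ∃ c : M.NonemptyFlat ↪o L, range c = {x | s x ≠ 0} ∧ ∀ F, s (c F) = m * F.1.ncard := by
  rw [tiplessBaselessCone, freeCone_eq_explicitCone] at h
  have h3 : ∀ e ∈ M.E,
      3 ≤ (coneSet m {e} \ (ConeElt.base '' M.E ∪ {ConeElt.tip})).encard := fun e he => by
    rw [coneSet_sdiff_base_tip (singleton_subset_iff.2 he), encard_copySet, encard_singleton,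
      mul_one]
    exact_mod_cast hm
  obtain ⟨c, hc, hs⟩ := exists_orderEmbedding_of_isConfiguration (one_le_two.trans hm.le)
    subset_union_left Subset.rfl h3 h
  refine ⟨c, hc, fun F => ?_⟩
  have h1 := hs F
  rw [coneSet_sdiff_base_tip F.2.1.subset_ground, encard_copySet,
    ← (M.ground_finite.subset F.2.1.subset_ground).cast_ncard_eq] at h1
  exact_mod_cast h1

end Configuration

end Matroid

theorem theorem4p4 {α : Type*} {β : Type*} (M : Matroid α) (N : Matroid β)
    [M.Finite] [M.Loopless] [N.Finite] [N.Loopless] :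
    -- here the parameter is not part of the data, so it may differ for `M` and `N`
    (∀ (m n : ℕ) (hm : 1 < m) (hn : 1 < n) {L : Type*} [PartialOrder L] (s ρ : L → ℕ),
      (M.tiplessCone m hm.le).IsConfiguration s ρ →
      (N.tiplessCone n hn.le).IsConfiguration s ρ → M.IsIsomorphic N) ∧
    -- from here on the parameter `m` is part of the data, hence common to `M` and `N`
    (∀ (m : ℕ) (hm : 1 < m) {L : Type*} [PartialOrder L] (s ρ : L → ℕ),
      (M.baselessCone m hm.le).IsConfiguration s ρ →
      (N.baselessCone m hm.le).IsConfiguration s ρ → M.IsIsomorphic N) ∧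
    (∀ (m : ℕ) (hm : 2 < m) {L : Type*} [PartialOrder L] (s ρ : L → ℕ),
      (M.tiplessBaselessCone m (one_le_two.trans hm.le)).IsConfiguration s ρ →
      (N.tiplessBaselessCone m (one_le_two.trans hm.le)).IsConfiguration s ρ →
      M.IsIsomorphic N) := by
  refine ⟨fun m n hm hn L _ s ρ hM hN => ?_, fun m hm L _ s ρ hM hN => ?_,
    fun m hm L _ s ρ hM hN => ?_⟩
  · rw [Matroid.tiplessCone, Matroid.freeCone_eq_explicitCone] at hM hN
    obtain ⟨C⟩ := Matroid.nonempty_tiplessConfiguration hm hM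
    obtain ⟨D⟩ := Matroid.nonempty_tiplessConfiguration hn hN
    exact C.isIsomorphic D hm hn
  · obtain ⟨c, hc, hcs⟩ := Matroid.exists_orderEmbedding_of_baselessCone hm hM
    obtain ⟨d, hd, hds⟩ := Matroid.exists_orderEmbedding_of_baselessCone hm hN
    refine Matroid.isIsomorphic_of_orderEmbedding c d (hc.trans hd.symm) fun P Q _ _ hPQ => ?_
    have h := hcs P
    rw [hPQ, hds] at h
    exact (Nat.eq_of_mul_eq_mul_left (by omega) (Nat.succ_injective h)).symm
  · obtain ⟨c, hc, hcs⟩ := Matroid.exists_orderEmbedding_of_tiplessBaselessCone hm hM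
    obtain ⟨d, hd, hds⟩ := Matroid.exists_orderEmbedding_of_tiplessBaselessCone hm hN
    refine Matroid.isIsomorphic_of_orderEmbedding c d (hc.trans hd.symm) fun P Q _ _ hPQ => ?_
    have h := hcs P
    rw [hPQ, hds] at h
    exact (Nat.eq_of_mul_eq_mul_left (by omega) h).symm
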